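/- Let $A\in\mathbb{Q}^{m\times n}$ with $m\ge 1$ and $\operatorname{rank}(A)=m$, let $L$ be its bit size (the sum over all entries $p/q$ in lowest terms of $1$ plus the binary lengths of $|p|$ and $q$), and let $\tau=2^{-L}$. Fix a step size $c\in(0,2)$. For a matrix $B$ with $r$ columns let $Q_B=B^T(BB^T)^{\dagger}B$, the orthogonal projection onto the row space of $B$. *Basic procedure* (input $Q=Q_B$). Start with $y=\mathbf 1/r$, $v=Qy$, and repeat the following. Put $z=y-v$. If $z>0$, return $z$ (case 1). Otherwise, if $v>0$ and $r=n$, return $v$ (case 2). Otherwise let $K=\{k: v_k\le 0\}$, $q_K=Q\sum_{k\in K}e_k$ and $\alpha=\langle q_K/\|q_K\|_2,v\rangle$ ($\alpha=0$ if $q_K=0$). If $\alpha\le -1/(2r^{3/2})$, replace $y$ by $y-c\frac{\alpha}{\|q_K\|_2}\sum_{k\in K}e_k$ and $v$ by $v-c\frac{\alpha}{\|q_K\|_2}q_K$. Otherwise return an arbitrary nonempty set $J\subseteq\{j: v_j\neq 0,\ \sum_i\max(0,-v_i/v_j)\le\tfrac12\}$ (a cut). *Main algorithm*. Start with $B=A$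 and $d=\mathbf 1\in\mathbb R^n$, and repeat the following. Run the basic procedure on $Q_B$. If it returns a cut $J$, halve $d_j$ and the $j$-th column of $B$ for all $j\in J$ (a rescaling), and then delete from $B$ all columns $i$ with $d_i\le\tau$, setting $d_i=0$. In case 1, return $x$ with $x_i=d_iz_i$ for the remaining columns $i$ and $x_i=0$ for the deleted ones (if no column is left, case 1 holds trivially and $x=0$). In case 2, return $v$ and $d$. **Theorem.** For every $c\in(0,2)$ there is a constant $C$, depending only on $c$, such that for all $A$ as above and all choices of the cuts, the main algorithm halts and solves the maximum support problem for $Ax=0,\ x\ge0,\ x\ne0$: either it returns a feasible solution $x$ whose set of positive coordinates contains that of every feasible solution; or it returns $x=0$ and the problem is infeasible; or it returns $v$ and $d>0$ with $v_j=d_j(A^Tu)_j$ for all $j$, for some $u$ with $A^Tu>0$, and the problem is infeasible. It performs at most $nL$ rescalings, and one call of the basic procedure more than rescalings. Each call of the basic procedure makes at most $Cn^2$ updates of $(y,v)$ and takes time at most $Cn^3m$, and the total time is at most $Cn^4mL$. Time is the number of steps on a machine with exact real numbers ($+,-,\times,/$, square roots, comparisons, memory writes and loop control at unit cost), with $Q_B$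 applied to vectors through an orthogonal basis of the row space of $B$, which is computed by Gram–Schmidt orthogonalization at the beginning of each pass of the main algorithm and which provably yields multiplication by $Q_B$. -/

import Mathlib

open scoped Matrix

/-! ### Real-number computations with a step count -/

/-- A computation of the real-number machine: it either runs forever or halts with a value and
the number of steps executed. One step is one arithmetic operation, square root or comparison of
real numbers, one write to memory, or one round of loop control. -/
structure Comp (α : Type) : Type where
  run : Part (α × ℕ)

namespace Comp

/-- The computation `p` halts with value `a` after exactly `t` steps. -/
def Returns {α : Type} (p : Comp α) (a : α) (t : ℕ) : Prop := (a, t) ∈ p.run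

/-- Sequencing adds the step counts. -/
noncomputable instance : Monad Comp where
  pure a := ⟨Part.some (a, 0)⟩
  bind p f := ⟨Part.bind p.run fun q => Part.map (fun s => (s.1, q.2 + s.2)) (f q.1).run⟩

/-- Spend `k` steps. -/
def tick (k : ℕ) : Comp Unit := ⟨Part.some ((), k)⟩

/-- Unit-cost addition. -/
noncomputable def add (x y : ℝ) : Comp ℝ := do tick 1; pure (x + y)

/-- Unit-cost subtraction. -/
noncomputable def sub (x y : ℝ) : Comp ℝ := do tick 1; pure (x - y)

/-- Unit-cost multiplication. -/
noncomputable def mul (x y : ℝ) : Comp ℝ := do tick 1; pure (x * y)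

/-- Unit-cost division. -/
noncomputable def div (x y : ℝ) : Comp ℝ := do tick 1; pure (x / y)

/-- Unit-cost square root. -/
noncomputable def sqrt (x : ℝ) : Comp ℝ := do tick 1; pure (Real.sqrt x)

/-- Unit-cost comparison `x ≤ y`. -/
noncomputable def le (x y : ℝ) : Comp Bool := do tick 1; pure (decide (x ≤ y))

/-- Unit-cost comparison `x = y`. -/
noncomputable def eq (x y : ℝ) : Comp Bool := do tick 1; pure (decide (x = y))

/-- One pass of a loop, with the steps so far carried along; every pass costs one extra step. -/
def loopPass {σ β : Type} (body : σ → Comp (β ⊕ σ)) : σ × ℕ →. (β × ℕ) ⊕ (σ × ℕ) :=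
  fun p => Part.map (fun q : (β ⊕ σ) × ℕ =>
    match q.1 with
    | Sum.inl b => Sum.inl (b, p.2 + q.2 + 1)
    | Sum.inr s => Sum.inr (s, p.2 + q.2 + 1)) (body p.1).run

/-- Run `body` on the current state until it exits with a result (`Sum.inl`). The loop diverges
if the body never exits. -/
noncomputable def loop {σ β : Type} (body : σ → Comp (β ⊕ σ)) (s : σ) : Comp β :=
  ⟨PFun.fix (loopPass body) (s, 0)⟩

/-- Run `p` and also report how many steps it took (pure bookkeeping, free of charge). -/
def measured {α : Type} (p : Comp α) : Comp (α × ℕ) :=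
  ⟨Part.map (fun q : α × ℕ => ((q.1, q.2), q.2)) p.run⟩

end Comp

open Comp

/-! ### Linear algebra routines

A vector lives in `Fin n → ℝ`. The columns that are still present are kept in a list `I` of
indices, and all routines touch only the coordinates in `I`. -/

section Routines

variable {m n : ℕ}

/-- The vector whose `i`-th entry is computed by `f i` for `i ∈ I`; all others are `0`. -/
noncomputable def tabulate (I : List (Fin n)) (f : Fin n → Comp ℝ) : Comp (Fin n → ℝ) :=
  I.foldlM (fun x i => do
    let a ← f i
    tick 1
    pure (Function.update x i a)) (fun _ => 0)

/-- The elements of a list that pass a test, in order. -/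
noncomputable def select (p : Fin n → Comp Bool) : List (Fin n) → Comp (List (Fin n))
  | [] => pure []
  | i :: l => do
    let b ← p i
    tick 1
    let l' ← select p l
    pure (if b then i :: l' else l')

/-- The number of elements of `I`, as a real number. -/
noncomputable def count (I : List (Fin n)) : Comp ℝ :=
  I.foldlM (fun s _ => add s 1) 0

/-- The inner product over the coordinates in `I`. -/
noncomputable def dot (I : List (Fin n)) (x y : Fin n → ℝ) : Comp ℝ :=
  I.foldlM (fun s i => do
    let p ← mul (x i) (y i)
    add s p) 0

/-- Test whether all coordinates in `I` are positive. -/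
noncomputable def allPos (I : List (Fin n)) (x : Fin n → ℝ) : Comp Bool :=
  I.foldlM (fun b i => do
    let c ← le (x i) 0
    pure (b && !c)) true

/-- For a list `W` of pairwise orthogonal nonzero vectors, the orthogonal projection of `u` onto
their span. -/
noncomputable def project (I : List (Fin n)) (W : List (Fin n → ℝ)) (u : Fin n → ℝ) :
    Comp (Fin n → ℝ) := do
  let o ← tabulate I (fun _ => pure 0)
  W.foldlM (fun x w => do
    let a ← dot I w u
    let b ← dot I w w
    let s ← div a b
    tabulate I (fun i => do
      let p ← mul s (w i)
      add (x i) p)) o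

/-- Gram–Schmidt orthogonalization of the rows of the matrix formed by the columns `I` of `M`:
an orthogonal basis of the row space, through which `project` applies the projection matrix
`Q = Mᵀ (M Mᵀ)† M` of that matrix. -/
noncomputable def rowBasis (I : List (Fin n)) (M : Matrix (Fin m) (Fin n) ℝ) :
    Comp (List (Fin n → ℝ)) :=
  (List.finRange m).foldlM (fun W i => do
    let p ← project I W (M i)
    let w ← tabulate I (fun j => sub (M i j) (p j))
    let b ← dot I w w
    let isZero ← eq b 0
    tick 1
    pure (if isZero then W else W ++ [w])) []

/-- Halve the coordinates `J` of `d`. -/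
noncomputable def halve (J : List (Fin n)) (d : Fin n → ℝ) : Comp (Fin n → ℝ) :=
  J.foldlM (fun d j => do
    let a ← div (d j) 2
    tick 1
    pure (Function.update d j a)) d

/-- Halve the columns `J` of `M`. -/
noncomputable def halveColumns (J : List (Fin n)) (M : Matrix (Fin m) (Fin n) ℝ) :
    Comp (Matrix (Fin m) (Fin n) ℝ) :=
  J.foldlM (fun M j =>
    (List.finRange m).foldlM (fun M i => do
      let a ← div (M i j) 2
      tick 1
      pure (Function.update M i (Function.update (M i) j a))) M) M

/-- Set the coordinates `H` of `d` to zero. -/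
noncomputable def zeroOut (H : List (Fin n)) (d : Fin n → ℝ) : Comp (Fin n → ℝ) :=
  H.foldlM (fun d j => do
    tick 1
    pure (Function.update d j 0)) d

end Routines

/-! ### The basic procedure -/

/-- What the basic procedure returns: a positive vector `z` of the null space (case 1), a
positive vector `v` of the row space (case 2), or a cut `J` (case 0). -/
inductive BPResult (n : ℕ) : Type
  | primal (z : Fin n → ℝ)
  | dual (v : Fin n → ℝ)
  | cut (J : List (Fin n))

section Basic

variable {n : ℕ}

/-- Test `bound_j ≤ 1/2` for a coordinate `j` with `v_j ≠ 0`, where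
`bound_j = ∑ i, max 0 (v_i / (-v_j))`; coordinates with `v_j = 0` give no bound. -/
noncomputable def cutTest (I : List (Fin n)) (v : Fin n → ℝ) (j : Fin n) : Comp Bool := do
  let isZero ← eq (v j) 0
  if isZero then pure false
  else do
    let a ← sub 0 (v j)
    let bound ← I.foldlM (fun s i => do
      let q ← div (v i) a
      let neg ← le q 0
      add s (if neg then 0 else q)) 0
    le bound (1 / 2)

/-- One pass of the basic procedure at `(y, v)`, after `t` completed updates. Here `W` is an
orthogonal basis of the row space, so that `project I W` is multiplication by `Q`; `r` is the
number of columns, `thr` the threshold, `c` the step size, and `pick` selects the cut `J` from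
the list of all indices `j` with `bound_j ≤ 1/2`. If `q_K = 0` then `α` is taken to be `0`. -/
noncomputable def bpBody (c : ℝ) (I : List (Fin n)) (W : List (Fin n → ℝ))
    (pick : List (Fin n) → List (Fin n)) (r thr : ℝ)
    (s : (Fin n → ℝ) × (Fin n → ℝ) × ℕ) :
    Comp ((BPResult n × ℕ) ⊕ ((Fin n → ℝ) × (Fin n → ℝ) × ℕ)) := do
  let y := s.1
  let v := s.2.1
  let t := s.2.2
  let z ← tabulate I (fun i => sub (y i) (v i))
  let zPos ← allPos I z
  let vPos ← allPos I v
  let full ← eq r n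
  if zPos then pure (Sum.inl (BPResult.primal z, t))
  else if vPos && full then pure (Sum.inl (BPResult.dual v, t))
  else do
    let K ← select (fun k => le (v k) 0) I
    let e ← tabulate K (fun _ => pure 1)
    let q ← project I W e
    let qq ← dot I q q
    let len ← sqrt qq
    let qv ← dot I q v
    let qZero ← eq len 0
    let α ← (if qZero then pure 0 else div qv len)
    let negThr ← sub 0 thr
    let large ← le α negThr
    if large then do
      let a ← div α len
      let b ← mul c a
      let y' ← tabulate I (fun i => do
        let p ← mul b (e i)
        sub (y i) p)
      let v' ← tabulate I (fun i => do
        let p ← mul b (q i)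
        sub (v i) p)
      pure (Sum.inr (y', v', t + 1))
    else do
      let B ← select (cutTest I v) I
      tick B.length
      pure (Sum.inl (BPResult.cut (pick B), t))

/-- The basic procedure: threshold `1 / (2 r^(3/2))`, start at `y = 𝟏/r`, `v = Q y`. It returns
the result and the number of updates of `(y, v)`. -/
noncomputable def basicProcedure (c : ℝ) (I : List (Fin n)) (W : List (Fin n → ℝ))
    (pick : List (Fin n) → List (Fin n)) : Comp (BPResult n × ℕ) := do
  let r ← count I
  let s ← sqrt r
  let rs ← mul r s
  let rs2 ← mul 2 rs
  let thr ← div 1 rs2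
  let y ← tabulate I (fun _ => div 1 r)
  let v ← project I W y
  loop (bpBody c I W pick r thr) (y, v, 0)

end Basic

/-! ### The main algorithm -/

/-- The result of the main algorithm: a vector `x` (case 1), or (case 2) the scaling `d` and a
positive vector `v` of the row space of `A * diagonal d`. -/
inductive Outcome (n : ℕ) : Type
  | primal (x : Fin n → ℝ)
  | dual (d v : Fin n → ℝ)

/-- Number of updates and running time of one call of the basic procedure. -/
structure BPCall : Type where
  iterations : ℕ
  time : ℕ

/-- The result of the main algorithm, together with the number of rescalings and the record of
all calls of the basic procedure. -/
structure Report (n : ℕ) : Type where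
  outcome : Outcome n
  rescalings : ℕ
  calls : List BPCall

/-- State of the main algorithm: scaling `d`, indices `I` of the columns that are still present,
current matrix `M` (only its columns in `I` matter), and the record so far. -/
structure MAState (m n : ℕ) : Type where
  d : Fin n → ℝ
  I : List (Fin n)
  M : Matrix (Fin m) (Fin n) ℝ
  rescalings : ℕ
  calls : List BPCall

section Main

variable {m n : ℕ}

/-- One pass of the main algorithm. `sel k` selects the cut of the `k`-th rescaling. -/
noncomputable def maBody (c τ : ℝ) (sel : ℕ → List (Fin n) → List (Fin n)) (s : MAState m n) :
    Comp (Report n ⊕ MAState m n) := do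
  let W ← rowBasis s.I s.M
  let out ← measured (basicProcedure c s.I W (sel s.rescalings))
  let calls := s.calls ++ [⟨out.1.2, out.2⟩]
  match out.1.1 with
  | BPResult.primal z => do
    tick n
    let x ← tabulate s.I (fun i => mul (s.d i) (z i))
    pure (Sum.inl ⟨Outcome.primal x, s.rescalings, calls⟩)
  | BPResult.dual v => pure (Sum.inl ⟨Outcome.dual s.d v, s.rescalings, calls⟩)
  | BPResult.cut J => do
    let d₁ ← halve J s.d
    let H ← select (fun i => le (d₁ i) τ) s.I
    let I' ← select (fun i => do
      let b ← le (d₁ i) τ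
      pure (!b)) s.I
    let d₂ ← zeroOut H d₁
    let M' ← halveColumns J s.M
    pure (Sum.inr ⟨d₂, I', M', s.rescalings + 1, calls⟩)

/-- The primal algorithm on the matrix `A`, with `τ = 2 ^ (-L)`, step size `c`, and cuts chosen
by `sel`. -/
noncomputable def primalAlgorithm (c : ℝ) (A : Matrix (Fin m) (Fin n) ℝ) (L : ℕ)
    (sel : ℕ → List (Fin n) → List (Fin n)) : Comp (Report n) := do
  let τ ← (List.range L).foldlM (fun t _ => div t 2) 1
  let d ← tabulate (List.finRange n) (fun _ => pure 1)
  loop (maBody c τ sel) ⟨d, List.finRange n, A, 0, []⟩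

end Main

/-! ### The specification -/

section Spec

variable {m n : ℕ}

/-- `sel` resolves the free choice of the cut: from the (nonempty) list of candidates of the
`k`-th rescaling it takes some nonempty subset. Every admissible sequence of choices is of this
form. -/
def IsSelectionRule (sel : ℕ → List (Fin n) → List (Fin n)) : Prop :=
  ∀ k B, B ≠ [] → sel k B ≠ [] ∧ (sel k B).Sublist B

/-- Feasibility for `A x = 0`, `x ≥ 0`, `x ≠ 0`. -/
def IsFeasible (A : Matrix (Fin m) (Fin n) ℝ) (x : Fin n → ℝ) : Prop :=
  A *ᵥ x = 0 ∧ (∀ i, 0 ≤ x i) ∧ x ≠ 0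

/-- A feasible solution whose set of positive coordinates is the inclusion-wise maximum. -/
def IsMaxSupportSolution (A : Matrix (Fin m) (Fin n) ℝ) (x : Fin n → ℝ) : Prop :=
  IsFeasible A x ∧ ∀ x', IsFeasible A x' → {i | 0 < x' i} ⊆ {i | 0 < x i}

/-- The outcome is a correct answer to the maximum support problem. The vector `x = 0` is
returned exactly when all columns have been removed and reports infeasibility; in case 2 the
vector `v` is a rescaled solution `Aᵀ u > 0` of the dual problem. -/
def Outcome.Solves (A : Matrix (Fin m) (Fin n) ℝ) : Outcome n → Prop
  | .primal x => IsMaxSupportSolution A x ∨ (x = 0 ∧ ¬ ∃ x', IsFeasible A x')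
  | .dual d v =>
      (∃ u : Fin m → ℝ, ∀ j, 0 < (Aᵀ *ᵥ u) j ∧ 0 < d j ∧ v j = d j * (Aᵀ *ᵥ u) j) ∧
        ¬ ∃ x', IsFeasible A x'

/-- The number of bits of a rational matrix: for each entry `p/q` in lowest terms a sign bit and
the binary lengths of `|p|` and `q`. -/
def bitSize (A : Matrix (Fin m) (Fin n) ℚ) : ℕ :=
  ∑ i, ∑ j, (1 + (A i j).num.natAbs.size + (A i j).den.size)

/-- `G` is the Moore–Penrose pseudoinverse of `M`. -/
def IsMoorePenrose {ι κ : Type} [Fintype ι] [Fintype κ] (M : Matrix ι κ ℝ)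
    (G : Matrix κ ι ℝ) : Prop :=
  M * G * M = M ∧ G * M * G = G ∧ (M * G)ᵀ = M * G ∧ (G * M)ᵀ = G * M

/-- The two linear algebra routines together multiply vectors by the projection matrix
`Q_B = Bᵀ (B Bᵀ)† B` of the matrix `B` formed by the columns `I` of `M`. -/
def ComputesRowProjection (I : List (Fin n)) (M : Matrix (Fin m) (Fin n) ℝ) : Prop :=
  ∃ W t, (rowBasis I M).Returns W t ∧
    ∃ G, let B : Matrix (Fin m) {i // i ∈ I} ℝ := M.submatrix id Subtype.val
      IsMoorePenrose (B * Bᵀ) G ∧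
        ∀ u : Fin n → ℝ, ∃ p t', (project I W u).Returns p t' ∧
          ∀ i : {i // i ∈ I}, p i = ((Bᵀ * G * B) *ᵥ fun j => u j) i

end Spec

/-! Correctness rests on one invariant: every null vector `x` of `A` in the unit cube satisfies `x ≤
d`. The columns of the current matrix are those of `A` scaled by `d`, so `x / d` is a null vector of
it in the unit cube and is orthogonal to its row space. A row-space vector `v` with `v j ≠ 0`
therefore bounds `x j / d j` (`le_cutBound`), and a bound of at most `1/2` justifies halving `d j`
(`MAInvariant.le_half`).

Deleting columns is justified by Cramer's rule. If a coordinate is positive in some nonnegative null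
vector, conic Carathéodory and determinant bounds give one in the cube where it exceeds `2^(-L)`
(`exists_feasible_in_cube`). Hence `d j ≤ τ` forces coordinate `j` to vanish in all solutions. The
remaining columns thus contain every support, so a null vector positive on all of them has maximum
support. A positive row-space vector on the full set of columns is a Farkas certificate of
infeasibility.

Rescalings are counted by exponents: `d j = 2^(-e j)` on the remaining columns, `e j ≤ L`
throughout, and each cut raises at least one exponent.

The basic procedure is driven by the potential `‖v‖²` with `v = Q y`. It is at most `1/r` at the
start, and an update lowers it by `c (2 - c) α² ≥ c (2 - c) / (4 r³)` (`update_dotProduct_self_le`),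
so there are `O(r²)` updates. As `α < 0` in an update, `y` only grows and stays at least `1/r`. When
neither an exit of case 1 or 2 nor an update applies, some `j` has `v j ≥ y j ≥ 1/r`, while the
negative entries of `v` sum in absolute value to `-⟨q_K, v⟩ = -α ‖q_K‖ ≤ 1/(2r)`. The bound for this
`j` is at most `1/2`, so a cut exists (`exists_cutBound_le`).

For the running time, `Within` composes along the programs, and `within_loop` handles both loops.
Gram–Schmidt leaves at most `m` vectors, so a projection costs `O(n m)`; this dominates an update.
-/

/-! ### Rules for step counts -/

namespace Comp

variable {α β σ : Type}

/-- The computation `p` halts with value `a` after at most `T` steps. -/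
def Within (p : Comp α) (a : α) (T : ℕ) : Prop := ∃ t ≤ T, p.Returns a t

theorem returns_pure (a : α) : (pure a : Comp α).Returns a 0 := Part.mem_some _

theorem returns_tick (k : ℕ) : (tick k).Returns () k := Part.mem_some _

theorem Returns.bind {p : Comp α} {f : α → Comp β} {a : α} {b : β} {s t : ℕ}
    (hp : p.Returns a s) (hf : (f a).Returns b t) : (p >>= f).Returns b (s + t) :=
  Part.mem_bind hp (Part.mem_map (fun q : β × ℕ => (q.1, s + q.2)) hf)

theorem Returns.measured {p : Comp α} {a : α} {t : ℕ} (hp : p.Returns a t) :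
    (Comp.measured p).Returns (a, t) t :=
  Part.mem_map (fun q : α × ℕ => ((q.1, q.2), q.2)) hp

theorem Returns.within {p : Comp α} {a : α} {t : ℕ} (hp : p.Returns a t) : Within p a t :=
  ⟨t, le_rfl, hp⟩

theorem Within.mono {p : Comp α} {a : α} {s t : ℕ} (h : Within p a s) (hst : s ≤ t) :
    Within p a t :=
  let ⟨u, hu, hp⟩ := h
  ⟨u, hu.trans hst, hp⟩

theorem Within.bind {p : Comp α} {f : α → Comp β} {a : α} {b : β} {s t : ℕ}
    (hp : Within p a s) (hf : Within (f a) b t) : Within (p >>= f) b (s + t) := by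
  obtain ⟨s', hs, hp⟩ := hp
  obtain ⟨t', ht, hf⟩ := hf
  exact ⟨s' + t', Nat.add_le_add hs ht, hp.bind hf⟩

theorem within_pure (a : α) : Within (pure a : Comp α) a 0 := (returns_pure a).within

theorem within_tick (k : ℕ) : Within (tick k) () k := (returns_tick k).within

theorem Within.tick_bind {f : Unit → Comp β} {b : β} {k t : ℕ} (hf : Within (f ()) b t) :
    Within (tick k >>= f) b (k + t) :=
  (within_tick k).bind hf

theorem within_tick_pure (a : α) : Within (do tick 1; pure a) a 1 :=
  Within.tick_bind (f := fun _ => pure a) (within_pure a)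

theorem within_add (x y : ℝ) : Within (add x y) (x + y) 1 := within_tick_pure _
theorem within_sub (x y : ℝ) : Within (sub x y) (x - y) 1 := within_tick_pure _
theorem within_mul (x y : ℝ) : Within (mul x y) (x * y) 1 := within_tick_pure _
theorem within_div (x y : ℝ) : Within (div x y) (x / y) 1 := within_tick_pure _
theorem within_sqrt (x : ℝ) : Within (sqrt x) (Real.sqrt x) 1 := within_tick_pure _
theorem within_le (x y : ℝ) : Within (le x y) (decide (x ≤ y)) 1 := within_tick_pure _
theorem within_eq (x y : ℝ) : Within (eq x y) (decide (x = y)) 1 := within_tick_pure _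

theorem within_foldlM {f : σ → β → Comp σ} {g : σ → β → σ} {k : ℕ} :
    ∀ (l : List β) (s : σ), (∀ s, ∀ i ∈ l, Within (f s i) (g s i) k) →
      Within (l.foldlM f s) (l.foldl g s) (l.length * k)
  | [], s, _ => (within_pure s).mono (Nat.zero_le _)
  | i :: l, s, h => by
    rw [List.foldlM_cons, List.foldl_cons]
    refine ((h s i (by simp)).bind
      (within_foldlM l (g s i) fun s j hj => h s j (by simp [hj]))).mono ?_
    rw [List.length_cons]
    exact le_of_eq (by ring)

/-- The counter carried by the loop never influences the body, so starting it at `k` only shifts the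
final count. This allows the remainder of a loop to be analysed as a fresh loop. -/
theorem fix_loopPass_add {body : σ → Comp (β ⊕ σ)} {s : σ} {b : β} {t : ℕ}
    (h : (b, t) ∈ PFun.fix (loopPass body) (s, 0)) (k : ℕ) :
    (b, k + t) ∈ PFun.fix (loopPass body) (s, k) := by
  -- The counter changes from pass to pass, so the fixed-point induction needs an arbitrary starting
  -- counter.
  suffices H : ∀ a : σ × ℕ, (b, t) ∈ PFun.fix (loopPass body) a →
      (b, k + t) ∈ PFun.fix (loopPass body) (a.1, k + a.2) from H (s, 0) h
  intro a ha
  refine PFun.fixInduction' (C := fun a => (b, k + t) ∈ PFun.fix (loopPass body) (a.1, k + a.2))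
    ha ?_ ?_
  · intro a ha
    refine PFun.mem_fix_iff.2 (Or.inl ?_)
    obtain ⟨⟨q, u⟩, hq, hq'⟩ := (Part.mem_map_iff _).1 ha
    refine (Part.mem_map_iff _).2 ⟨(q, u), hq, ?_⟩
    cases q <;> simp at hq' ⊢
    obtain ⟨rfl, rfl⟩ := hq'
    simp; ring
  · intro a a' _ ha' ih
    refine PFun.mem_fix_iff.2 (Or.inr ⟨(a'.1, k + a'.2), ?_, ih⟩)
    obtain ⟨⟨q, u⟩, hq, hq'⟩ := (Part.mem_map_iff _).1 ha'
    refine (Part.mem_map_iff _).2 ⟨(q, u), hq, ?_⟩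
    cases q <;> simp at hq' ⊢
    subst hq'
    simp; ring

theorem Within.loop_exit {body : σ → Comp (β ⊕ σ)} {s : σ} {b : β} {t : ℕ}
    (h : Within (body s) (Sum.inl b) t) : Within (loop body s) b (t + 1) := by
  obtain ⟨u, hu, h⟩ := h
  refine ⟨u + 1, by omega, PFun.mem_fix_iff.2 (Or.inl ((Part.mem_map_iff _).2 ⟨_, h, ?_⟩))⟩
  simp

theorem Within.loop_continue {body : σ → Comp (β ⊕ σ)} {s s' : σ} {b : β} {t T : ℕ}
    (h : Within (body s) (Sum.inr s') t) (h' : Within (loop body s') b T) :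
    Within (loop body s) b (t + 1 + T) := by
  obtain ⟨u, hu, h⟩ := h
  obtain ⟨v, hv, h'⟩ := h'
  refine ⟨u + 1 + v, by omega, PFun.mem_fix_iff.2 (Or.inr ⟨(s', u + 1), ?_, ?_⟩)⟩
  · exact (Part.mem_map_iff _).2 ⟨_, h, by simp⟩
  · exact fix_loopPass_add h' _

/-- A loop with an invariant and a decreasing measure, where a pass costs at most `k` steps and the
last one at most `e` steps. -/
theorem within_loop {body : σ → Comp (β ⊕ σ)} (Inv : σ → Prop) (Post : β → Prop) (size : σ → ℕ)
    (k e : ℕ)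
    (h : ∀ s, Inv s → (∃ b, Post b ∧ Within (body s) (Sum.inl b) e) ∨
      ∃ s', Inv s' ∧ size s' < size s ∧ Within (body s) (Sum.inr s') k) (s : σ) (hs : Inv s) :
    ∃ b, Post b ∧ Within (loop body s) b (size s * (k + 1) + (e + 1)) := by
  induction hN : size s using Nat.strong_induction_on generalizing s with
  | _ N ih =>
    subst hN
    rcases h s hs with ⟨b, hb, hw⟩ | ⟨s', hs', hlt, hw⟩
    · exact ⟨b, hb, hw.loop_exit.mono (by omega)⟩
    · obtain ⟨b, hb, hw'⟩ := ih _ hlt s' hs' rfl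
      refine ⟨b, hb, (hw.loop_continue hw').mono ?_⟩
      -- The drop of the measure by at least one pays for this pass, `k` steps and one of loop
      -- control.
      have := Nat.mul_le_mul_right (k + 1) (Nat.succ_le_of_lt hlt)
      rw [Nat.succ_mul] at this
      omega

end Comp

/-! ### Values and costs of the routines -/

/-- The vector that agrees with `x` on the coordinates in `I` and vanishes elsewhere. -/
def restrictTo {n : ℕ} (I : List (Fin n)) (x : Fin n → ℝ) : Fin n → ℝ :=
  fun i => if i ∈ I then x i else 0

/-- The vector `x` vanishes outside `I`. -/
def SupportedOn {n : ℕ} (I : List (Fin n)) (x : Fin n → ℝ) : Prop := ∀ i, i ∉ I → x i = 0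

section RoutineSpecs

variable {m n : ℕ}

theorem supportedOn_restrictTo (I : List (Fin n)) (x : Fin n → ℝ) :
    SupportedOn I (restrictTo I x) := fun _ hi => if_neg hi

theorem restrictTo_apply_of_mem {I : List (Fin n)} {i : Fin n} (hi : i ∈ I) (x : Fin n → ℝ) :
    restrictTo I x i = x i := if_pos hi

theorem SupportedOn.restrictTo_eq {I : List (Fin n)} {x : Fin n → ℝ} (h : SupportedOn I x) :
    restrictTo I x = x := by
  funext i
  by_cases hi : i ∈ I
  · exact if_pos hi
  · rw [h i hi]; exact if_neg hi

/-- Here the new entry depends on the old one, so a repeated index would apply `g` twice; hence the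
list must be duplicate-free. -/
theorem foldl_update_of_nodup {ι γ : Type} [DecidableEq ι] (g : ι → γ → γ) (l : List ι)
    (hl : l.Nodup) (x : ι → γ) :
    l.foldl (fun x i => Function.update x i (g i (x i))) x =
      fun i => if i ∈ l then g i (x i) else x i := by
  induction l generalizing x with
  | nil => simp
  | cons j l ih =>
    rw [List.nodup_cons] at hl
    rw [List.foldl_cons, ih hl.2]
    funext i
    by_cases hij : i = j
    · subst hij; simp [hl.1]
    · simp [hij]

theorem foldl_update_const {ι γ : Type} [DecidableEq ι] (g : ι → γ) (l : List ι) (x : ι → γ) :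
    l.foldl (fun x i => Function.update x i (g i)) x = fun i => if i ∈ l then g i else x i := by
  induction l generalizing x with
  | nil => simp
  | cons j l ih =>
    rw [List.foldl_cons, ih]
    funext i
    by_cases hij : i = j
    · subst hij; simp
    · simp [hij]

theorem within_tabulate {I : List (Fin n)} {f : Fin n → Comp ℝ} {g : Fin n → ℝ} {k : ℕ}
    (h : ∀ i ∈ I, Within (f i) (g i) k) :
    Within (tabulate I f) (restrictTo I g) (I.length * (k + 1)) := by
  have := within_foldlM (f := fun (x : Fin n → ℝ) i => (do
    let a ← f i
    tick 1
    pure (Function.update x i a) : Comp (Fin n → ℝ))) (g := fun x i => Function.update x i (g i))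
    (k := k + 1) I (fun _ => 0) fun s i hi =>
      Within.mono ((h i hi).bind (within_tick_pure _)) le_rfl
  rw [foldl_update_const] at this
  exact this

theorem within_select {p : Fin n → Comp Bool} {q : Fin n → Bool} {k : ℕ} :
    ∀ (I : List (Fin n)), (∀ i ∈ I, Within (p i) (q i) k) →
      Within (select p I) (I.filter q) (I.length * (k + 1))
  | [], _ => (within_pure _).mono (Nat.zero_le _)
  | i :: l, h => by
    have hl := within_select l fun j hj => h j (by simp [hj])
    have := (h i (by simp)).bind (f := fun b => (do
      tick 1
      let l' ← select p l
      pure (if b then i :: l' else l') : Comp (List (Fin n))))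
      (hl.bind (f := fun l' => pure (if q i then i :: l' else l')) (within_pure _)).tick_bind
    rw [List.filter_cons]
    refine Within.mono this ?_
    rw [List.length_cons]
    exact le_of_eq (by ring)

theorem within_count (I : List (Fin n)) : Within (count I) (I.length : ℝ) I.length := by
  have := within_foldlM (f := fun (s : ℝ) (_ : Fin n) => add s 1) (g := fun s _ => s + 1) (k := 1)
    I 0 fun s _ _ => within_add s 1
  have h : ∀ (l : List (Fin n)) (a : ℝ), l.foldl (fun s _ => s + 1) a = a + l.length := by
    intro l
    induction l with
    | nil => simp
    | cons _ l ih => intro a; simp [ih]; ring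
  rw [h, zero_add, mul_one] at this
  exact this

/-- Sums over the remaining columns become sums over all of `Fin n`. The whole analysis can then use
ordinary inner products of zero-extended vectors. -/
theorem foldl_add_eq_sum {ι : Type} [Fintype ι] [DecidableEq ι] {l : List ι} (hl : l.Nodup)
    {g : ι → ℝ} (hg : ∀ i, i ∉ l → g i = 0) : l.foldl (fun s i => s + g i) 0 = ∑ i, g i := by
  have h : ∀ (l : List ι) (a : ℝ), l.foldl (fun s i => s + g i) a = a + (l.map g).sum := by
    intro l
    induction l with
    | nil => simp
    | cons _ l ih => intro a; simp [ih, add_assoc]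
  rw [h, zero_add, ← List.sum_toFinset g hl]
  exact Finset.sum_subset (Finset.subset_univ _) fun i _ hi => hg i (by simpa using hi)

theorem within_dot {I : List (Fin n)} (hI : I.Nodup) {x : Fin n → ℝ} (hx : SupportedOn I x)
    (y : Fin n → ℝ) : Within (dot I x y) (x ⬝ᵥ y) (I.length * 2) := by
  have := within_foldlM (f := fun (s : ℝ) (i : Fin n) => (do
    let p ← mul (x i) (y i)
    add s p : Comp ℝ)) (g := fun s i => s + x i * y i) (k := 2)
    I 0 fun s _ _ => (within_mul _ _).bind (within_add s _)
  rw [foldl_add_eq_sum hI fun i hi => by rw [hx i hi, zero_mul]] at this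
  exact this

theorem within_allPos (I : List (Fin n)) (x : Fin n → ℝ) :
    Within (allPos I x) (decide (∀ i ∈ I, 0 < x i)) I.length := by
  have := within_foldlM (f := fun (b : Bool) (i : Fin n) => (do
    let c ← le (x i) 0
    pure (b && !c) : Comp Bool)) (g := fun b i => b && !(decide (x i ≤ 0))) (k := 1)
    I true fun s _ _ => Within.mono (Within.bind (within_le _ _) (within_pure _)) le_rfl
  have h : ∀ (l : List (Fin n)) (a : Bool), l.foldl (fun b i => b && !(decide (x i ≤ 0))) a =
      (a && decide (∀ i ∈ l, 0 < x i)) := by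
    intro l
    induction l with
    | nil => simp
    | cons i l ih =>
      intro a
      have hi : decide (0 < x i) = !decide (x i ≤ 0) := by
        rw [← decide_not]
        exact decide_eq_decide.2 not_le.symm
      rw [List.foldl_cons, ih]
      simp [Bool.and_assoc, hi]
  rw [h, Bool.true_and, mul_one] at this
  exact this

/-- The orthogonal projection of `u` onto the span of the pairwise orthogonal vectors `W`. -/
noncomputable def orthProj (W : List (Fin n → ℝ)) (u : Fin n → ℝ) : Fin n → ℝ :=
  (W.map fun w => (w ⬝ᵥ u / w ⬝ᵥ w) • w).sum

/-- Each `tabulate` zeroes everything outside `I`; the accumulator survives because it and the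
vectors of `W` vanish there. Orthogonality of `W` plays no role for this formula. -/
theorem within_project {I : List (Fin n)} (hI : I.Nodup) {W : List (Fin n → ℝ)}
    (hW : ∀ w ∈ W, SupportedOn I w) (u : Fin n → ℝ) :
    Within (project I W u) (orthProj W u) (I.length + W.length * (I.length * 7 + 1)) := by
  have key : ∀ V : List (Fin n → ℝ), (∀ w ∈ V, SupportedOn I w) → ∀ x : Fin n → ℝ,
      SupportedOn I x → Within (V.foldlM (fun x w => do
        let a ← dot I w u
        let b ← dot I w w
        let s ← div a b
        tabulate I (fun i => do
          let p ← mul s (w i)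
          add (x i) p)) x) (x + orthProj V u) (V.length * (I.length * 7 + 1)) := by
    intro V
    induction V with
    | nil => intro _ x _; simpa [orthProj] using within_pure x
    | cons w V ih =>
      intro hV x hx
      have hw := hV w (by simp)
      have hstep : restrictTo I (fun i => x i + w ⬝ᵥ u / w ⬝ᵥ w * w i) =
          x + (w ⬝ᵥ u / w ⬝ᵥ w) • w := by
        apply SupportedOn.restrictTo_eq
        intro i hi
        simp [hx i hi, hw i hi]
      rw [List.foldlM_cons]
      refine Within.mono (Within.bind (a := x + (w ⬝ᵥ u / w ⬝ᵥ w) • w)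
        ((within_dot hI hw u).bind ((within_dot hI hw w).bind ((within_div _ _).bind
          (t := I.length * (1 + 1 + 1)) ?_)))
        (b := x + orthProj (w :: V) u) (t := V.length * (I.length * 7 + 1)) ?_) ?_
      · rw [← hstep]
        exact within_tabulate fun i _ => (within_mul _ _).bind (within_add _ _)
      · have : x + orthProj (w :: V) u = x + (w ⬝ᵥ u / w ⬝ᵥ w) • w + orthProj V u := by
          simp [orthProj, add_assoc]
        rw [this]
        refine ih (fun w' hw' => hV w' (by simp [hw'])) _ fun i hi => ?_
        simp [hx i hi, hw i hi]
      · rw [List.length_cons]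
        exact le_of_eq (by ring)
  have h0 : restrictTo I (fun _ => (0 : ℝ)) = 0 := by funext i; simp [restrictTo]
  have ho := h0 ▸ within_tabulate (I := I) (f := fun _ => pure 0) (g := fun _ => 0) (k := 0)
    fun i _ => within_pure 0
  have := ho.bind (f := fun o => W.foldlM (fun x w => do
        let a ← dot I w u
        let b ← dot I w w
        let s ← div a b
        tabulate I (fun i => do
          let p ← mul s (w i)
          add (x i) p)) o) (key W hW 0 fun _ _ => rfl)
  rw [zero_add, zero_add, mul_one] at this
  exact this

theorem within_halve {J : List (Fin n)} (hJ : J.Nodup) (d : Fin n → ℝ) :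
    Within (halve J d) (fun i => if i ∈ J then d i / 2 else d i) (J.length * 2) := by
  have := within_foldlM (f := fun (d : Fin n → ℝ) (j : Fin n) => (do
    let a ← div (d j) 2
    tick 1
    pure (Function.update d j a) : Comp (Fin n → ℝ)))
    (g := fun d j => Function.update d j (d j / 2)) (k := 2) J d fun s i _ =>
      Within.mono (Within.bind (within_div _ _) (within_tick_pure _)) le_rfl
  rw [foldl_update_of_nodup (fun _ a => a / 2) J hJ d] at this
  exact this

theorem within_zeroOut (H : List (Fin n)) (d : Fin n → ℝ) :
    Within (zeroOut H d) (fun i => if i ∈ H then 0 else d i) H.length := by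
  have := within_foldlM (f := fun (d : Fin n → ℝ) (j : Fin n) => (do
    tick 1
    pure (Function.update d j 0) : Comp (Fin n → ℝ)))
    (g := fun d j => Function.update d j 0) (k := 1) H d fun s i _ => within_tick_pure _
  rw [foldl_update_const, mul_one] at this
  exact this

theorem within_halveColumns {J : List (Fin n)} (hJ : J.Nodup) (M : Matrix (Fin m) (Fin n) ℝ) :
    Within (halveColumns J M) (fun i j => if j ∈ J then M i j / 2 else M i j)
      (J.length * (m * 2)) := by
  have hcol : ∀ (M : Matrix (Fin m) (Fin n) ℝ) (j : Fin n),
      Within ((List.finRange m).foldlM (fun M i => (do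
        let a ← div (M i j) 2
        tick 1
        pure (Function.update M i (Function.update (M i) j a)) :
          Comp (Matrix (Fin m) (Fin n) ℝ))) M)
        (fun i => Function.update (M i) j (M i j / 2)) (m * 2) := by
    intro M j
    have := within_foldlM (f := fun (M : Matrix (Fin m) (Fin n) ℝ) (i : Fin m) => (do
        let a ← div (M i j) 2
        tick 1
        pure (Function.update M i (Function.update (M i) j a)) :
          Comp (Matrix (Fin m) (Fin n) ℝ)))
      (g := fun M i => Function.update M i (Function.update (M i) j (M i j / 2))) (k := 2)
      (List.finRange m) M fun s i _ =>
        Within.mono (Within.bind (within_div _ _) (within_tick_pure _)) le_rfl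
    have h : List.foldl (α := Matrix (Fin m) (Fin n) ℝ)
        (fun M i => Function.update M i (Function.update (M i) j (M i j / 2))) M
        (List.finRange m) =
        fun i => if i ∈ List.finRange m then Function.update (M i) j (M i j / 2) else M i :=
      foldl_update_of_nodup (fun _ r => Function.update r j (r j / 2)) _ (List.nodup_finRange m) M
    simp only [h, List.length_finRange, List.mem_finRange, if_true] at this
    exact this
  have := within_foldlM (f := fun (M : Matrix (Fin m) (Fin n) ℝ) (j : Fin n) =>
    (List.finRange m).foldlM (fun M i => (do
      let a ← div (M i j) 2
      tick 1
      pure (Function.update M i (Function.update (M i) j a)) :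
        Comp (Matrix (Fin m) (Fin n) ℝ))) M)
    (g := fun M j i => Function.update (M i) j (M i j / 2)) J M fun M j _ => hcol M j
  have h : ∀ (l : List (Fin n)), l.Nodup → ∀ M : Fin m → Fin n → ℝ,
      l.foldl (fun M j i => Function.update (M i) j (M i j / 2)) M =
        fun i j => if j ∈ l then M i j / 2 else M i j := by
    intro l
    induction l with
    | nil => intro _ M; simp
    | cons k l ih =>
      intro hl M
      rw [List.nodup_cons] at hl
      rw [List.foldl_cons, ih hl.2]
      funext i j
      by_cases hjk : j = k
      · subst hjk; simp [hl.1]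
      · simp [hjk]
  exact (h J hJ M) ▸ this

end RoutineSpecs

/-! ### Orthogonal projections and Gram–Schmidt orthogonalization -/

section Projection

variable {m n : ℕ}

theorem dotProduct_self_pos {x : Fin n → ℝ} (hx : x ≠ 0) : 0 < x ⬝ᵥ x :=
  lt_of_le_of_ne (Finset.sum_nonneg fun i _ => mul_self_nonneg (x i))
    fun h => hx (dotProduct_self_eq_zero.1 h.symm)

theorem dotProduct_self_nonneg_real (x : Fin n → ℝ) : 0 ≤ x ⬝ᵥ x :=
  Finset.sum_nonneg fun i _ => mul_self_nonneg (x i)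

/-- Pairwise orthogonal nonzero vectors that vanish outside `I`. -/
structure IsOrthogonalList (I : List (Fin n)) (W : List (Fin n → ℝ)) : Prop where
  supported : ∀ w ∈ W, SupportedOn I w
  ne_zero : ∀ w ∈ W, w ≠ 0
  pairwise : W.Pairwise fun w w' => w ⬝ᵥ w' = 0

/-- The subspace spanned by the vectors of a list. -/
def listSpan (W : List (Fin n → ℝ)) : Submodule ℝ (Fin n → ℝ) :=
  Submodule.span ℝ {w | w ∈ W}

theorem orthProj_cons (w : Fin n → ℝ) (W : List (Fin n → ℝ)) (u : Fin n → ℝ) :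
    orthProj (w :: W) u = (w ⬝ᵥ u / w ⬝ᵥ w) • w + orthProj W u := by simp [orthProj]

theorem orthProj_mem (W : List (Fin n → ℝ)) (u : Fin n → ℝ) : orthProj W u ∈ listSpan W := by
  refine list_sum_mem fun x hx => ?_
  obtain ⟨w, hw, rfl⟩ := List.mem_map.1 hx
  exact Submodule.smul_mem _ _ (Submodule.subset_span hw)

theorem orthProj_sub (W : List (Fin n → ℝ)) (u v : Fin n → ℝ) :
    orthProj W (u - v) = orthProj W u - orthProj W v := by
  induction W with
  | nil => simp [orthProj]
  | cons w W ih =>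
    rw [orthProj_cons, orthProj_cons, orthProj_cons, ih, dotProduct_sub, sub_div, sub_smul]
    abel

theorem orthProj_smul (W : List (Fin n → ℝ)) (b : ℝ) (u : Fin n → ℝ) :
    orthProj W (b • u) = b • orthProj W u := by
  induction W with
  | nil => simp [orthProj]
  | cons w W ih => rw [orthProj_cons, orthProj_cons, ih, dotProduct_smul, smul_add, smul_smul,
      smul_eq_mul, mul_div_assoc]

theorem dotProduct_orthProj_eq_zero {W : List (Fin n → ℝ)} {x : Fin n → ℝ}
    (h : ∀ w ∈ W, x ⬝ᵥ w = 0) (u : Fin n → ℝ) : x ⬝ᵥ orthProj W u = 0 := by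
  induction W with
  | nil => simp [orthProj]
  | cons w W ih =>
    rw [orthProj_cons, dotProduct_add, dotProduct_smul, h w (by simp),
      ih fun w' hw' => h w' (by simp [hw'])]
    simp

variable {I : List (Fin n)} {W : List (Fin n → ℝ)}

/-- By orthogonality only the term of `w` itself contributes, and its coefficient is normalised by
`w ⬝ᵥ w ≠ 0`. -/
theorem IsOrthogonalList.dotProduct_orthProj_of_mem (hW : IsOrthogonalList I W)
    (u : Fin n → ℝ) : ∀ w ∈ W, w ⬝ᵥ orthProj W u = w ⬝ᵥ u := by
  induction W with
  | nil => simp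
  | cons w W ih =>
    obtain ⟨hs, hne, hp⟩ := hW
    rw [List.pairwise_cons] at hp
    intro w' hw'
    rw [orthProj_cons, dotProduct_add, dotProduct_smul]
    rcases List.mem_cons.1 hw' with rfl | hw'
    · rw [dotProduct_orthProj_eq_zero hp.1, smul_eq_mul, add_zero,
        div_mul_cancel₀ _ (dotProduct_self_pos (hne _ (by simp))).ne']
    · rw [ih ⟨fun x hx => hs x (by simp [hx]), fun x hx => hne x (by simp [hx]), hp.2⟩ w' hw',
        dotProduct_comm w' w, hp.1 w' hw', smul_zero, zero_add]

theorem IsOrthogonalList.dotProduct_orthProj (hW : IsOrthogonalList I W) {x : Fin n → ℝ}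
    (hx : x ∈ listSpan W) (u : Fin n → ℝ) : x ⬝ᵥ orthProj W u = x ⬝ᵥ u := by
  induction hx using Submodule.span_induction with
  | mem x hx => exact hW.dotProduct_orthProj_of_mem u x hx
  | zero => simp
  | add x y _ _ hx hy => rw [add_dotProduct, add_dotProduct, hx, hy]
  | smul a x _ hx => rw [smul_dotProduct, smul_dotProduct, hx]

/-- The orthogonal projection is the only vector of the span with the right inner products. -/
theorem IsOrthogonalList.orthProj_eq (hW : IsOrthogonalList I W) {p u : Fin n → ℝ}
    (hp : p ∈ listSpan W) (h : ∀ x ∈ listSpan W, x ⬝ᵥ p = x ⬝ᵥ u) : orthProj W u = p := by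
  have hmem := Submodule.sub_mem _ (orthProj_mem W u) hp
  have : (orthProj W u - p) ⬝ᵥ (orthProj W u - p) = 0 := by
    rw [dotProduct_sub, hW.dotProduct_orthProj hmem, h _ hmem, sub_self]
  exact sub_eq_zero.1 (dotProduct_self_eq_zero.1 this)

theorem IsOrthogonalList.orthProj_of_mem (hW : IsOrthogonalList I W) {x : Fin n → ℝ}
    (hx : x ∈ listSpan W) : orthProj W x = x := hW.orthProj_eq hx fun _ _ => rfl

theorem IsOrthogonalList.orthProj_dotProduct (hW : IsOrthogonalList I W) (u v : Fin n → ℝ) :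
    orthProj W u ⬝ᵥ v = u ⬝ᵥ orthProj W v := by
  rw [← hW.dotProduct_orthProj (orthProj_mem W u), dotProduct_comm,
    hW.dotProduct_orthProj (orthProj_mem W v), dotProduct_comm]

/-- Pythagoras: the squared norm of the residual is the difference of the two sides. -/
theorem IsOrthogonalList.orthProj_dotProduct_self_le (hW : IsOrthogonalList I W)
    (u : Fin n → ℝ) : orthProj W u ⬝ᵥ orthProj W u ≤ u ⬝ᵥ u := by
  have h := dotProduct_self_nonneg_real (u - orthProj W u)
  have h1 := hW.dotProduct_orthProj (orthProj_mem W u) u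
  rw [sub_dotProduct, dotProduct_sub, dotProduct_sub, dotProduct_comm u (orthProj W u)] at h
  linarith

theorem IsOrthogonalList.supportedOn_of_mem_span (hW : IsOrthogonalList I W) {x : Fin n → ℝ}
    (hx : x ∈ listSpan W) : SupportedOn I x := by
  intro i hi
  induction hx using Submodule.span_induction with
  | mem x hx => exact hW.supported x hx i hi
  | zero => rfl
  | add x y _ _ hx hy => simp [hx, hy]
  | smul a x _ hx => simp [hx]

theorem SupportedOn.restrictTo_dotProduct {x : Fin n → ℝ} (hx : SupportedOn I x)
    (u : Fin n → ℝ) : restrictTo I u ⬝ᵥ x = u ⬝ᵥ x := by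
  refine Finset.sum_congr rfl fun i _ => ?_
  by_cases hi : i ∈ I
  · rw [restrictTo_apply_of_mem hi]
  · rw [hx i hi, mul_zero, mul_zero]

/-- The row space of the matrix formed by the columns `I` of `M`, extended by zeros. -/
def rowSpace (I : List (Fin n)) (M : Matrix (Fin m) (Fin n) ℝ) : Submodule ℝ (Fin n → ℝ) :=
  Submodule.span ℝ (Set.range fun i => restrictTo I (M i))

theorem restrictTo_vecMul_mem_rowSpace (I : List (Fin n)) (M : Matrix (Fin m) (Fin n) ℝ)
    (a : Fin m → ℝ) : restrictTo I (a ᵥ* M) ∈ rowSpace I M := by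
  have : restrictTo I (a ᵥ* M) = ∑ i, a i • restrictTo I (M i) := by
    funext j
    by_cases hj : j ∈ I <;> simp [restrictTo, hj, Matrix.vecMul, dotProduct]
  rw [this]
  exact Submodule.sum_mem _ fun i _ => Submodule.smul_mem _ _ (Submodule.subset_span ⟨i, rfl⟩)

theorem exists_of_mem_rowSpace {M : Matrix (Fin m) (Fin n) ℝ} {x : Fin n → ℝ}
    (hx : x ∈ rowSpace I M) : ∃ a : Fin m → ℝ, x = restrictTo I (a ᵥ* M) := by
  obtain ⟨a, ha⟩ := (Submodule.mem_span_range_iff_exists_fun ℝ).1 hx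
  refine ⟨a, ha.symm.trans ?_⟩
  funext j
  by_cases hj : j ∈ I <;> simp [restrictTo, hj, Matrix.vecMul, dotProduct]

/-- Vectors of the row space are orthogonal to the null space. -/
theorem dotProduct_eq_zero_of_mem_rowSpace {M : Matrix (Fin m) (Fin n) ℝ} {s x : Fin n → ℝ}
    (hs : s ∈ rowSpace I M) (hx : SupportedOn I x) (hM : M *ᵥ x = 0) : s ⬝ᵥ x = 0 := by
  obtain ⟨a, rfl⟩ := exists_of_mem_rowSpace hs
  rw [hx.restrictTo_dotProduct, ← Matrix.dotProduct_mulVec, hM, dotProduct_zero]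

theorem mulVec_eq_zero_of_orthogonal {M : Matrix (Fin m) (Fin n) ℝ} {x : Fin n → ℝ}
    (hx : SupportedOn I x) (h : ∀ s ∈ rowSpace I M, s ⬝ᵥ x = 0) : M *ᵥ x = 0 := by
  funext i
  have := h _ (Submodule.subset_span ⟨i, rfl⟩)
  rw [hx.restrictTo_dotProduct] at this
  exact this

/-- The values of Gram–Schmidt orthogonalization. -/
theorem exists_within_rowBasis (hI : I.Nodup) (M : Matrix (Fin m) (Fin n) ℝ) :
    ∃ W, Within (rowBasis I M) W
        (m * (I.length + m * (I.length * 7 + 1) + I.length * 4 + 2)) ∧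
      IsOrthogonalList I W ∧ W.length ≤ m ∧ listSpan W = rowSpace I M := by
  have key : ∀ (l : List (Fin m)) (W : List (Fin n → ℝ)), IsOrthogonalList I W →
      W.length + l.length ≤ m → listSpan W ≤ rowSpace I M →
      ∃ W', Within (l.foldlM (fun W i => do
          let p ← project I W (M i)
          let w ← tabulate I (fun j => sub (M i j) (p j))
          let b ← dot I w w
          let isZero ← eq b 0
          tick 1
          pure (if isZero then W else W ++ [w])) W) W'
          (l.length * (I.length + m * (I.length * 7 + 1) + I.length * 4 + 2)) ∧
        IsOrthogonalList I W' ∧ W'.length ≤ m ∧ listSpan W' ≤ rowSpace I M ∧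
        listSpan W ≤ listSpan W' ∧ ∀ i ∈ l, restrictTo I (M i) ∈ listSpan W' := by
    intro l
    induction l with
    | nil =>
      intro W hW hlen hle
      exact ⟨W, (within_pure W).mono (Nat.zero_le _), hW, by simpa using hlen, hle, le_rfl,
        by simp⟩
    | cons i l ih =>
      intro W hW hlen hle
      rw [List.length_cons] at hlen
      set p := orthProj W (M i) with hp
      set w := restrictTo I (fun j => M i j - p j) with hw
      have hws : SupportedOn I w := supportedOn_restrictTo _ _
      have hps : SupportedOn I p := hW.supportedOn_of_mem_span (orthProj_mem _ _)
      have hwp : w = restrictTo I (M i) - p := by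
        funext j
        by_cases hj : j ∈ I
        · simp [hw, restrictTo, hj]
        · simp [hw, restrictTo, hj, hps j hj]
      -- The row and its projection have equal inner products with the vectors of `W`; restricting
      -- the row to `I` does not affect these, as `W` vanishes outside `I`.
      have hort : ∀ x ∈ W, x ⬝ᵥ w = 0 := by
        intro x hx
        rw [hwp, dotProduct_sub, hp, hW.dotProduct_orthProj_of_mem _ x hx, dotProduct_comm x,
          (hW.supported x hx).restrictTo_dotProduct, dotProduct_comm x, sub_self]
      have hcost : W.length * (I.length * 7 + 1) ≤ m * (I.length * 7 + 1) :=
        Nat.mul_le_mul_right _ (by omega)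
      have hstep : Within (do
          let p ← project I W (M i)
          let w ← tabulate I (fun j => sub (M i j) (p j))
          let b ← dot I w w
          let isZero ← eq b 0
          tick 1
          pure (if isZero then W else W ++ [w]))
          (if w ⬝ᵥ w = 0 then W else W ++ [w])
          (I.length + m * (I.length * 7 + 1) + I.length * 4 + 2) := by
        refine Within.mono (Within.bind (within_project hI hW.supported (M i))
          (Within.bind (within_tabulate fun j _ => within_sub _ _)
            (Within.bind (within_dot hI (supportedOn_restrictTo _ _) _)
              (Within.bind (within_eq _ _) (t := 1) ?_)))) ?_
        · have := within_tick_pure (if decide (w ⬝ᵥ w = 0) then W else W ++ [w])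
          simpa only [decide_eq_true_eq] using this
        · omega
      set W₁ := if w ⬝ᵥ w = 0 then W else W ++ [w] with hW₁
      have h₁ : IsOrthogonalList I W₁ ∧ W₁.length ≤ W.length + 1 ∧ listSpan W₁ ≤ rowSpace I M ∧
          listSpan W ≤ listSpan W₁ ∧ restrictTo I (M i) ∈ listSpan W₁ := by
        by_cases h0 : w ⬝ᵥ w = 0
        · rw [hW₁, if_pos h0]
          refine ⟨hW, by omega, hle, le_rfl, ?_⟩
          -- A zero residual means that the row already lies in the span.
          rw [dotProduct_self_eq_zero, hwp, sub_eq_zero] at h0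
          rw [h0]
          exact orthProj_mem _ _
        · rw [hW₁, if_neg h0]
          have hsub : listSpan W ≤ listSpan (W ++ [w]) :=
            Submodule.span_mono fun x (hx : x ∈ W) =>
              show x ∈ W ++ [w] from List.mem_append_left _ hx
          refine ⟨⟨?_, ?_, ?_⟩, by simp, ?_, hsub, ?_⟩
          · intro x hx
            rcases List.mem_append.1 hx with hx | hx
            · exact hW.supported x hx
            · rw [List.mem_singleton.1 hx]; exact hws
          · intro x hx
            rcases List.mem_append.1 hx with hx | hx
            · exact hW.ne_zero x hx
            · rw [List.mem_singleton.1 hx]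
              exact fun h => h0 (by rw [h, dotProduct_zero])
          · refine List.pairwise_append.2 ⟨hW.pairwise, List.pairwise_singleton _ _, ?_⟩
            intro x hx y hy
            rw [List.mem_singleton.1 hy]
            exact hort x hx
          · refine Submodule.span_le.2 fun x hx => ?_
            rcases List.mem_append.1 (show x ∈ W ++ [w] from hx) with hx | hx
            · exact hle (Submodule.subset_span hx)
            · rw [List.mem_singleton.1 hx, hwp]
              exact Submodule.sub_mem _ (Submodule.subset_span ⟨i, rfl⟩) (hle (orthProj_mem _ _))
          · have : restrictTo I (M i) = w + p := by rw [hwp]; abel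
            rw [this]
            exact Submodule.add_mem _ (Submodule.subset_span (by simp)) (hsub (orthProj_mem _ _))
      obtain ⟨hO₁, hlen₁, hle₁, hmono₁, hmem₁⟩ := h₁
      obtain ⟨W', hW', hO, hlen', hle', hmono, hmem⟩ := ih W₁ hO₁ (by omega) hle₁
      refine ⟨W', ?_, hO, hlen', hle', hmono₁.trans hmono, ?_⟩
      · rw [List.foldlM_cons]
        refine (hstep.bind hW').mono (le_of_eq ?_)
        rw [List.length_cons]
        ring
      · intro j hj
        rcases List.mem_cons.1 hj with rfl | hj
        · exact hmono hmem₁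
        · exact hmem j hj
  obtain ⟨W, hW, hO, hlen, hle, _, hmem⟩ := key (List.finRange m) [] ⟨by simp, by simp, by simp⟩
    (by simp) (Submodule.span_le.2 (by simp))
  refine ⟨W, ?_, hO, hlen, le_antisymm hle (Submodule.span_le.2 ?_)⟩
  · rw [List.length_finRange] at hW
    exact hW
  · rintro _ ⟨i, rfl⟩
    exact hmem i (List.mem_finRange i)

/-- A real symmetric matrix has a Moore–Penrose pseudoinverse. -/
theorem exists_isMoorePenrose_of_isSymm {ι : Type} [Fintype ι] [DecidableEq ι]
    {S : Matrix ι ι ℝ} (hS : Sᵀ = S) : ∃ G : Matrix ι ι ℝ, IsMoorePenrose S G := by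
  have hH : S.IsHermitian := by
    rw [Matrix.IsHermitian, Matrix.conjTranspose_eq_transpose_of_trivial, hS]
  set U : Matrix ι ι ℝ := (hH.eigenvectorUnitary : Matrix ι ι ℝ) with hU
  have hUU : Uᵀ * U = 1 := by
    have := Matrix.UnitaryGroup.star_mul_self hH.eigenvectorUnitary
    rwa [Matrix.star_eq_conjTranspose, Matrix.conjTranspose_eq_transpose_of_trivial] at this
  have hspec : S = U * Matrix.diagonal hH.eigenvalues * Uᵀ := by
    have := hH.spectral_theorem
    rw [Unitary.conjStarAlgAut_apply, Matrix.star_eq_conjTranspose,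
      Matrix.conjTranspose_eq_transpose_of_trivial] at this
    exact this
  set l := hH.eigenvalues with hl
  have hmul : ∀ a b : ι → ℝ, (U * Matrix.diagonal a * Uᵀ) * (U * Matrix.diagonal b * Uᵀ) =
      U * Matrix.diagonal (fun i => a i * b i) * Uᵀ := by
    intro a b
    calc (U * Matrix.diagonal a * Uᵀ) * (U * Matrix.diagonal b * Uᵀ)
        = U * Matrix.diagonal a * (Uᵀ * U) * Matrix.diagonal b * Uᵀ := by
          simp only [Matrix.mul_assoc]
      _ = _ := by rw [hUU, Matrix.mul_one, Matrix.mul_assoc U, Matrix.diagonal_mul_diagonal]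
  have htr : ∀ a : ι → ℝ, (U * Matrix.diagonal a * Uᵀ)ᵀ = U * Matrix.diagonal a * Uᵀ := by
    intro a
    simp [Matrix.transpose_mul, Matrix.mul_assoc]
  -- The convention `0⁻¹ = 0` is exactly the pseudoinverse rule for zero eigenvalues.
  refine ⟨U * Matrix.diagonal (fun i => (l i)⁻¹) * Uᵀ, ⟨?_, ?_, ?_, ?_⟩⟩
  · rw [hspec, hmul, hmul]
    simp only [mul_inv_mul_cancel]
  · rw [hspec, hmul, hmul]
    congr 3
    funext i
    rcases eq_or_ne (l i) 0 with h | h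
    · simp [h]
    · field_simp
  · rw [hspec, hmul, htr]
  · rw [hspec, hmul, htr]

/-- Gram–Schmidt orthogonalization followed by `project` multiplies by `Bᵀ (B Bᵀ)† B`. -/
theorem computesRowProjection (hI : I.Nodup) (M : Matrix (Fin m) (Fin n) ℝ) :
    ComputesRowProjection I M := by
  obtain ⟨W, ⟨t, -, ht⟩, hO, -, hspan⟩ := exists_within_rowBasis hI M
  refine ⟨W, t, ht, ?_⟩
  set B : Matrix (Fin m) {i // i ∈ I} ℝ := M.submatrix id Subtype.val with hB
  obtain ⟨G, hG⟩ := exists_isMoorePenrose_of_isSymm (S := B * Bᵀ) (by simp)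
  refine ⟨G, hG, fun u => ?_⟩
  obtain ⟨t', -, ht'⟩ := within_project hI hO.supported u
  refine ⟨_, t', ht', ?_⟩
  -- For `E = B Bᵀ G B - B` the first Penrose identity gives `E Bᵀ = 0`. Since `Eᵀ` has the left
  -- factor `Bᵀ`, it follows that `E Eᵀ = 0`, hence `E = 0`.
  have hBG : B * (Bᵀ * G * B) = B := by
    have h0 : (B * Bᵀ * G * B - B) * (B * Bᵀ * G * B - B)ᵀ = 0 := by
      have h1 : (B * Bᵀ * G * B - B) * Bᵀ = 0 := by
        rw [Matrix.sub_mul, Matrix.mul_assoc _ B, hG.1, sub_self]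
      have h2 : (B * Bᵀ * G * B - B)ᵀ = Bᵀ * (B * Bᵀ * G - 1)ᵀ := by
        rw [← Matrix.transpose_mul, Matrix.sub_mul, Matrix.one_mul]
      rw [h2, ← Matrix.mul_assoc, h1, Matrix.zero_mul]
    rw [← Matrix.conjTranspose_eq_transpose_of_trivial (B * Bᵀ * G * B - B),
      Matrix.self_mul_conjTranspose_eq_zero] at h0
    rw [← sub_eq_zero, ← h0]
    simp only [Matrix.mul_assoc]
  set uI : {i // i ∈ I} → ℝ := fun j => u j with huI
  have hsum : ∀ x : Fin n → ℝ, SupportedOn I x → ∀ i, (M *ᵥ x) i = (B *ᵥ fun j => x j) i := by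
    intro x hx i
    have h1 : ∑ j : {j // j ∈ I}, M i j * x j = ∑ j ∈ I.toFinset, M i j * x j := by
      rw [← Finset.sum_coe_sort I.toFinset]
      exact Fintype.sum_equiv (Equiv.subtypeEquivRight fun j => by simp) _ _ fun _ => rfl
    refine Eq.trans ?_ h1.symm
    show ∑ j, M i j * x j = _
    refine (Finset.sum_subset (Finset.subset_univ _) fun j _ hj => ?_).symm
    rw [hx j (by simpa using hj), mul_zero]
  set a : Fin m → ℝ := G *ᵥ (B *ᵥ uI) with ha
  have hq : ∀ i : {i // i ∈ I}, restrictTo I (a ᵥ* M) i = ((Bᵀ * G * B) *ᵥ uI) i := by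
    intro i
    rw [restrictTo_apply_of_mem i.2, ← Matrix.mulVec_mulVec, ← Matrix.mulVec_mulVec, ← ha,
      Matrix.mulVec_transpose]
    rfl
  have hproj : orthProj W u = restrictTo I (a ᵥ* M) := by
    refine hO.orthProj_eq (hspan ▸ restrictTo_vecMul_mem_rowSpace I M a) fun x hx => ?_
    have hxs := hO.supportedOn_of_mem_span hx
    rw [hspan] at hx
    have hd : SupportedOn I (restrictTo I u - restrictTo I (a ᵥ* M)) := fun i hi => by
      simp [supportedOn_restrictTo _ _ i hi]
    -- The residual is a null vector, hence orthogonal to the row space; this characterises the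
    -- projection.
    have h0 : M *ᵥ (restrictTo I u - restrictTo I (a ᵥ* M)) = 0 := by
      funext i
      rw [hsum _ hd]
      have : (fun j : {j // j ∈ I} => (restrictTo I u - restrictTo I (a ᵥ* M)) j) =
          uI - (Bᵀ * G * B) *ᵥ uI := by
        funext j
        rw [Pi.sub_apply, Pi.sub_apply, hq, restrictTo_apply_of_mem j.2]
      rw [this, Matrix.mulVec_sub, Matrix.mulVec_mulVec, hBG, sub_self]
    have h1 := dotProduct_eq_zero_of_mem_rowSpace hx hd h0
    rw [dotProduct_sub, sub_eq_zero, dotProduct_comm x (restrictTo I u),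
      hxs.restrictTo_dotProduct, dotProduct_comm u] at h1
    exact h1.symm
  intro i
  rw [hproj, hq]

end Projection

/-! ### Rational solutions of small size -/

section BitSize

variable {m n : ℕ}

/-- Expanding the product of row sums gives one term for every map `ι → ι`; the Leibniz formula uses
only those coming from permutations. -/
theorem abs_det_le_prod_sum {ι : Type} [Fintype ι] [DecidableEq ι] (N : Matrix ι ι ℝ) :
    |N.det| ≤ ∏ i, ∑ j, |N i j| := by
  rw [Matrix.det_apply, Finset.prod_univ_sum, Fintype.piFinset_univ]
  refine (Finset.abs_sum_le_sum_abs _ _).trans ?_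
  have h : ∀ σ : Equiv.Perm ι, |Equiv.Perm.sign σ • ∏ i, N (σ i) i| = ∏ i, |N i (σ.symm i)| := by
    intro σ
    rw [← Equiv.prod_comp σ (fun i => |N i (σ.symm i)|)]
    rcases Int.units_eq_one_or (Equiv.Perm.sign σ) with h | h <;> simp [h, Finset.abs_prod]
  rw [Finset.sum_congr rfl fun σ _ => h σ]
  have hinj : Function.Injective fun (σ : Equiv.Perm ι) (i : ι) => σ.symm i := by
    intro σ τ hστ
    exact Equiv.symm_bijective.injective (Equiv.ext (congrFun hστ))
  rw [← Finset.sum_image (f := fun p : ι → ι => ∏ i, |N i (p i)|)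
    (g := fun (σ : Equiv.Perm ι) (i : ι) => σ.symm i) fun σ _ τ _ h => hinj h]
  exact Finset.sum_le_sum_of_subset_of_nonneg (Finset.subset_univ _) fun p _ _ =>
    Finset.prod_nonneg fun i _ => abs_nonneg _

/-- Multiplying each row by the product of its denominators yields an integer matrix, whose nonzero
determinant has absolute value at least `1`. -/
theorem one_le_abs_det_mul_prod_den {ι : Type} [Fintype ι] [DecidableEq ι] {N : Matrix ι ι ℚ}
    (hN : N.det ≠ 0) : 1 ≤ |N.det| * ∏ i, ∏ j, ((N i j).den : ℚ) := by
  set ρ : ι → ℚ := fun i => ∏ j, ((N i j).den : ℚ) with hρ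
  have hρ0 : ∀ i, 0 < ρ i := fun i => Finset.prod_pos fun j _ => by exact_mod_cast (N i j).den_pos
  have hint : ∀ i j, ∃ z : ℤ, (z : ℚ) = ρ i * N i j := by
    intro i j
    refine ⟨(∏ k ∈ Finset.univ.erase j, ((N i k).den : ℤ)) * (N i j).num, ?_⟩
    rw [hρ]
    dsimp only
    rw [← Finset.prod_erase_mul _ _ (Finset.mem_univ j)]
    push_cast
    rw [mul_assoc, Rat.den_mul_eq_num]
  choose Z hZ using hint
  have hdet : ((Matrix.det (Matrix.of Z) : ℤ) : ℚ) = (∏ i, ρ i) * N.det := by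
    rw [← Matrix.det_mul_column, ← eq_intCast (Int.castRingHom ℚ), RingHom.map_det]
    congr 1
    ext i j
    simp [hZ]
  have hne : (Matrix.of Z).det ≠ 0 := by
    intro h
    rw [h, Int.cast_zero] at hdet
    exact mul_ne_zero (Finset.prod_ne_zero_iff.2 fun i _ => (hρ0 i).ne') hN hdet.symm
  have h1 : (1 : ℚ) ≤ |((Matrix.of Z).det : ℚ)| := by
    exact_mod_cast Int.one_le_abs hne
  rw [hdet, abs_mul, abs_of_pos (Finset.prod_pos fun i _ => hρ0 i), mul_comm] at h1
  exact h1

/-- The expanded product contains every summand. This turns row sums into a product over entries, to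
be compared with the bit size entry by entry. -/
theorem sum_abs_le_prod_one_add {ι : Type} [Fintype ι] (a : ι → ℝ) :
    ∑ i, |a i| ≤ ∏ i, (1 + |a i|) := by
  classical
  have h : ∀ s : Finset ι, 1 + ∑ i ∈ s, |a i| ≤ ∏ i ∈ s, (1 + |a i|) := by
    intro s
    induction s using Finset.induction_on with
    | empty => simp
    | insert i s hi ih =>
      rw [Finset.sum_insert hi, Finset.prod_insert hi]
      have h1 := abs_nonneg (a i)
      have h2 : 0 ≤ ∑ i ∈ s, |a i| := Finset.sum_nonneg fun i _ => abs_nonneg _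
      nlinarith
  linarith [h Finset.univ]

theorem sum_subtype_ne_zero_mul (a : Fin n → ℝ) {u v : Fin n → ℝ} (h : ∀ j, v j = 0 → u j = 0) :
    ∑ k : {j // v j ≠ 0}, a k * u k = ∑ j, a j * u j := by
  rw [← Finset.sum_subtype (Finset.univ.filter fun j => v j ≠ 0) (by simp) fun j => a j * u j]
  refine Finset.sum_subset (Finset.subset_univ _) fun j _ hj => ?_
  rw [h j (by simpa using hj), mul_zero]

/-- The omitted factors are at least `1`, so one bound serves all minors. -/
theorem prod_submatrix_le {κ : Type} [Fintype κ] [DecidableEq κ] {f : κ → Fin m} {g : κ → Fin n}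
    (hf : Function.Injective f) (hg : Function.Injective g) {a : Fin m → Fin n → ℝ}
    (ha : ∀ i j, 1 ≤ a i j) : ∏ r, ∏ s, a (f r) (g s) ≤ ∏ i, ∏ j, a i j := by
  have h1 : ∀ i, ∏ s, a i (g s) ≤ ∏ j, a i j := by
    intro i
    rw [← Finset.prod_image (f := fun j => a i j) (g := g) fun x _ y _ h => hg h]
    exact Finset.prod_le_prod_of_subset_of_one_le (Finset.subset_univ _)
      (fun j _ => zero_le_one.trans (ha i j)) fun j _ _ => ha i j
  have h2 : ∀ i, 1 ≤ ∏ j, a i j := fun i => Finset.one_le_prod fun j _ => ha i j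
  refine (Finset.prod_le_prod (fun r _ => Finset.prod_nonneg fun s _ =>
    zero_le_one.trans (ha _ _)) fun r _ => h1 (f r)).trans ?_
  rw [← Finset.prod_image (f := fun i => ∏ j, a i j) (g := f) fun x _ y _ h => hf h]
  exact Finset.prod_le_prod_of_subset_of_one_le (Finset.subset_univ _)
    (fun i _ => zero_le_one.trans (h2 i)) fun i _ _ => h2 i

/-- Linearly independent columns contain a nonsingular square submatrix. -/
theorem exists_rows_det_ne_zero {κ : Type} [Fintype κ] [DecidableEq κ] {A : Matrix (Fin m) κ ℝ}
    (hA : LinearIndependent ℝ A.col) :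
    ∃ f : κ → Fin m, Function.Injective f ∧ (A.submatrix f id).det ≠ 0 := by
  have hrank : Module.finrank ℝ (Submodule.span ℝ (Set.range A.row)) = Fintype.card κ := by
    rw [← Matrix.rank_eq_finrank_span_row, ← Matrix.rank_transpose]
    exact LinearIndependent.rank_matrix hA
  obtain ⟨s, a, ha, hspan, hli⟩ := exists_linearIndependent' ℝ A.row
  have : Finite s := Finite.of_injective a ha
  have := Fintype.ofFinite s
  have hcard : Fintype.card s = Fintype.card κ := by
    rw [← hrank, ← hspan, finrank_span_eq_card hli]
  let e : κ ≃ s := Fintype.equivOfCardEq hcard.symm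
  refine ⟨a ∘ e, ha.comp e.injective, ?_⟩
  have hli' : LinearIndependent ℝ (A.submatrix (a ∘ e) id).row := hli.comp e e.injective
  exact ((Matrix.isUnit_iff_isUnit_det _).1 (Matrix.linearIndependent_rows_iff_isUnit.1 hli')).ne_zero

/-- Conic Carathéodory: a nonnegative solution can be replaced by one that is supported on
linearly independent columns. -/
theorem exists_linearIndependent_support (A : Matrix (Fin m) (Fin n) ℝ) (w : Fin n → ℝ)
    (hw : ∀ j, 0 ≤ w j) :
    ∃ w' : Fin n → ℝ, (∀ j, 0 ≤ w' j) ∧ A *ᵥ w' = A *ᵥ w ∧ (∀ j, w j = 0 → w' j = 0) ∧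
      LinearIndependent ℝ fun j : {j // w' j ≠ 0} => A.col j := by
  induction hN : (Finset.univ.filter fun j => w j ≠ 0).card using Nat.strong_induction_on
    generalizing w with
  | _ N ih =>
    subst hN
    by_cases hli : LinearIndependent ℝ fun j : {j // w j ≠ 0} => A.col j
    · exact ⟨w, hw, rfl, fun _ h => h, hli⟩
    rw [Fintype.not_linearIndependent_iff] at hli
    obtain ⟨g, hg, j₀, hj₀⟩ := hli
    obtain ⟨u, hu, huA, k, hk⟩ : ∃ u : Fin n → ℝ, (∀ j, w j = 0 → u j = 0) ∧ A *ᵥ u = 0 ∧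
        ∃ k, 0 < u k := by
      let u : Fin n → ℝ := fun j => if h : w j ≠ 0 then g ⟨j, h⟩ else 0
      have hu : ∀ j, w j = 0 → u j = 0 := fun j hj => dif_neg (not_not.2 hj)
      have hug : ∀ j : {j // w j ≠ 0}, u j = g j := fun j => dif_pos j.2
      have huA : A *ᵥ u = 0 := by
        rw [← hg]
        funext i
        show ∑ j, A i j * u j = _
        rw [← sum_subtype_ne_zero_mul (A i) hu, Finset.sum_apply]
        exact Finset.sum_congr rfl fun j _ => by
          rw [hug, Pi.smul_apply, smul_eq_mul, mul_comm]; rfl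
      -- Flipping the sign of the dependence if necessary provides a positive entry for the ratio
      -- test.
      rcases lt_or_gt_of_ne hj₀ with h | h
      · exact ⟨-u, fun j hj => by simp [hu j hj], by rw [Matrix.mulVec_neg, huA, neg_zero], j₀,
          by rw [Pi.neg_apply, hug]; linarith⟩
      · exact ⟨u, hu, huA, j₀, by rw [hug]; exact h⟩
    -- Ratio test: the minimal quotient is the largest step along `-u` that keeps `w` nonnegative,
    -- and it makes coordinate `l` vanish.
    obtain ⟨l, hl, hmin⟩ := Finset.exists_min_image (Finset.univ.filter fun j => 0 < u j)
      (fun j => w j / u j) ⟨k, by simpa using hk⟩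
    simp only [Finset.mem_filter, Finset.mem_univ, true_and] at hl hmin
    set t := w l / u l with ht
    have ht0 : 0 ≤ t := div_nonneg (hw l) hl.le
    set w₁ : Fin n → ℝ := fun j => w j - t * u j with hw₁
    have hw₁0 : ∀ j, 0 ≤ w₁ j := by
      intro j
      rcases lt_or_ge 0 (u j) with h | h
      · have := hmin j h
        rw [le_div_iff₀ h] at this
        exact sub_nonneg.2 this
      · have := mul_nonneg ht0 (neg_nonneg.2 h)
        have := hw j
        simp only [hw₁]
        linarith
    have hsub : ∀ j, w j = 0 → w₁ j = 0 := fun j hj => by simp [hw₁, hj, hu j hj]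
    have hl₁ : w₁ l = 0 := by simp [hw₁, ht, hl.ne']
    have hcard : (Finset.univ.filter fun j => w₁ j ≠ 0).card <
        (Finset.univ.filter fun j => w j ≠ 0).card := by
      refine Finset.card_lt_card (Finset.ssubset_iff_of_subset ?_ |>.2 ⟨l, ?_, ?_⟩)
      · intro j
        simpa using fun h h' => h (hsub j h')
      · simpa using fun h => hl.ne' (hu l h)
      · simpa using hl₁
    obtain ⟨w', h0, hA, hs, hli⟩ := ih _ hcard w₁ hw₁0 rfl
    refine ⟨w', h0, hA.trans ?_, fun j hj => hs j (hsub j hj), hli⟩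
    have : w₁ = w - t • u := by funext j; simp [hw₁]
    rw [this, Matrix.mulVec_sub, Matrix.mulVec_smul, huA, smul_zero, sub_zero]

/-- For `q = a/b` the left side is `b + |a| ≤ b (1 + |a|)`, and each of `b` and `|a| + 1` is at most
two to the corresponding binary length. The sign bit is not spent here. -/
theorem den_mul_one_add_abs_le (q : ℚ) :
    (q.den : ℝ) * (1 + |(q : ℝ)|) ≤ 2 ^ (q.num.natAbs.size + q.den.size) := by
  have hd : (0 : ℝ) < q.den := by exact_mod_cast q.den_pos
  have h1 : (q.den : ℝ) ≤ 2 ^ q.den.size := by exact_mod_cast (Nat.lt_size_self q.den).le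
  have h2 : (q.num.natAbs : ℝ) + 1 ≤ 2 ^ q.num.natAbs.size := by
    exact_mod_cast Nat.succ_le_of_lt (Nat.lt_size_self q.num.natAbs)
  have h3 : |(q : ℝ)| ≤ q.num.natAbs := by
    have h : (q : ℝ) = q.num / q.den := by exact_mod_cast (Rat.num_div_den q).symm
    rw [h, abs_div, abs_of_pos hd, Nat.cast_natAbs, Int.cast_abs]
    exact div_le_self (abs_nonneg _) (by exact_mod_cast q.den_pos)
  rw [pow_add, mul_comm]
  exact mul_le_mul (by linarith) h1 hd.le (by positivity)

/-- Strictness comes from the sign bits, of which there is at least one because the matrix is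
nonempty. -/
theorem prod_den_mul_one_add_abs_lt [NeZero m] [NeZero n] (A : Matrix (Fin m) (Fin n) ℚ) :
    (∏ i, ∏ j, ((A i j).den : ℝ)) * ∏ i, ∏ j, (1 + |(A i j : ℝ)|) < 2 ^ bitSize A := by
  have h1 : (∏ i, ∏ j, ((A i j).den : ℝ)) * ∏ i, ∏ j, (1 + |(A i j : ℝ)|) ≤
      2 ^ ∑ i, ∑ j, ((A i j).num.natAbs.size + (A i j).den.size) := by
    rw [← Finset.prod_mul_distrib, ← Finset.prod_pow_eq_pow_sum]
    refine Finset.prod_le_prod (fun i _ => by positivity) fun i _ => ?_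
    rw [← Finset.prod_mul_distrib, ← Finset.prod_pow_eq_pow_sum]
    exact Finset.prod_le_prod (fun j _ => by positivity) fun j _ => den_mul_one_add_abs_le _
  refine h1.trans_lt (pow_lt_pow_right₀ one_lt_two ?_)
  refine Finset.sum_lt_sum_of_nonempty ⟨0, Finset.mem_univ _⟩ fun i _ => ?_
  exact Finset.sum_lt_sum_of_nonempty ⟨0, Finset.mem_univ _⟩ fun j _ => by omega

/-- If coordinate `i` is positive in some feasible solution, then it exceeds `2 ^ (-L)` in some
feasible solution of the unit cube. -/
theorem exists_feasible_in_cube [NeZero m] [NeZero n] (A : Matrix (Fin m) (Fin n) ℚ)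
    {x : Fin n → ℝ} (hx : ∀ j, 0 ≤ x j) (hAx : A.map (fun q : ℚ => (q : ℝ)) *ᵥ x = 0) {i : Fin n}
    (hi : 0 < x i) :
    ∃ y : Fin n → ℝ, A.map (fun q : ℚ => (q : ℝ)) *ᵥ y = 0 ∧ (∀ j, 0 ≤ y j ∧ y j ≤ 1) ∧
      1 / 2 ^ bitSize A < y i := by
  set R := A.map (fun q : ℚ => (q : ℝ)) with hR
  set P := (∏ i, ∏ j, ((A i j).den : ℝ)) * ∏ i, ∏ j, (1 + |(A i j : ℝ)|) with hP
  have hden : ∀ i j, (1 : ℝ) ≤ ((A i j).den : ℝ) := fun i j => by exact_mod_cast (A i j).den_pos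
  have habs : ∀ i j, 1 ≤ 1 + |(A i j : ℝ)| := fun i j => by
    have := abs_nonneg (A i j : ℝ); linarith
  have hP1 : 1 ≤ P := one_le_mul_of_one_le_of_one_le
    (Finset.one_le_prod fun i _ => Finset.one_le_prod fun j _ => hden i j)
    (Finset.one_le_prod fun i _ => Finset.one_le_prod fun j _ => habs i j)
  -- normalise the coordinate `i` to `1` and solve for the others
  set w : Fin n → ℝ := fun j => if j = i then 0 else x j / x i with hw
  have hw0 : ∀ j, 0 ≤ w j := by
    intro j
    by_cases h : j = i
    · simp [hw, h]
    · simpa [hw, h] using div_nonneg (hx j) hi.le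
  have hxw : x = x i • (w + Pi.single i 1) := by
    funext j
    by_cases h : j = i
    · subst h; simp [hw]
    · simp [hw, h]; field_simp
  have hAw : R *ᵥ w = -R.col i := by
    rw [hxw, Matrix.mulVec_smul, smul_eq_zero_iff_right hi.ne', Matrix.mulVec_add,
      Matrix.mulVec_single_one] at hAx
    exact eq_neg_of_add_eq_zero_left hAx
  obtain ⟨v, hv0, hv, hsupp, hli⟩ := exists_linearIndependent_support R w hw0
  rw [hAw] at hv
  have hvi : v i = 0 := hsupp i (by simp [hw])
  have hvP : ∀ j, v j ≤ P := by
    intro j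
    by_cases hj : v j = 0
    · rw [hj]; linarith
    set κ := {j // v j ≠ 0}
    let k : κ := ⟨j, hj⟩
    obtain ⟨f, hf, hdet⟩ := exists_rows_det_ne_zero (A := R.submatrix id (Subtype.val : κ → Fin n))
      hli
    set N : Matrix κ κ ℝ := R.submatrix f Subtype.val with hN
    replace hdet : N.det ≠ 0 := hdet
    have hsol : N *ᵥ (fun k : κ => v k) = fun r => -R (f r) i := by
      funext r
      have := congrFun hv (f r)
      rw [Pi.neg_apply, Matrix.col_apply] at this
      rw [← this]
      show ∑ k : κ, R (f r) k * v k = ∑ j, R (f r) j * v j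
      exact sum_subtype_ne_zero_mul (R (f r)) fun _ h => h
    -- Cramer's rule for the square system that determines the nonzero entries of `v`.
    have hcramer : N.det * v j = N.cramer (fun r => -R (f r) i) k := by
      rw [← hsol, Matrix.cramer_eq_adjugate_mulVec, Matrix.mulVec_mulVec, Matrix.adjugate_mul,
        Matrix.smul_mulVec, Matrix.one_mulVec]
      rfl
    -- Up to the sign of one column, the numerator is the minor of `A` with column `k` replaced by
    -- `i`. As `v i = 0`, column `i` is not among the others, so the columns stay distinct and
    -- `prod_submatrix_le` applies.
    let g : κ → Fin n := fun l => if l = k then i else l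
    have hg : Function.Injective g := by
      intro l l' h
      have hne : ∀ l : κ, (l : Fin n) ≠ i := fun l h => l.2 (by rw [h, hvi])
      by_cases h1 : l = k <;> by_cases h2 : l' = k <;> simp only [g, h1, h2, if_true, if_false] at h
      · rw [h1, h2]
      · exact absurd h.symm (hne l')
      · exact absurd h (hne l)
      · exact Subtype.ext h
    have hnum : |N.cramer (fun r => -R (f r) i) k| ≤ ∏ i, ∏ j, (1 + |(A i j : ℝ)|) := by
      rw [Matrix.cramer_apply]
      refine (abs_det_le_prod_sum _).trans ?_
      refine le_trans ?_ (prod_submatrix_le hf hg habs)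
      refine Finset.prod_le_prod (fun r _ => Finset.sum_nonneg fun _ _ => abs_nonneg _)
        fun r _ => ?_
      refine le_trans (le_of_eq ?_) (sum_abs_le_prod_one_add fun l => (A (f r) (g l) : ℝ))
      refine Finset.sum_congr rfl fun l _ => ?_
      by_cases h : l = k
      · subst h; simp [g, hR]
      · simp [g, hR, hN, h]
    have hdenom : 1 ≤ |N.det| * ∏ i, ∏ j, ((A i j).den : ℝ) := by
      have hND : N.det = (((A.submatrix f Subtype.val).det : ℚ) : ℝ) := by
        rw [← Rat.coe_castHom, RingHom.map_det]
        rfl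
      have hne : (A.submatrix f (Subtype.val : κ → Fin n)).det ≠ 0 := by
        intro h
        rw [hND, h, Rat.cast_zero] at hdet
        exact hdet rfl
      have h1 := one_le_abs_det_mul_prod_den hne
      have h2 : (1 : ℝ) ≤ |N.det| * ∏ r, ∏ s : κ, ((A (f r) s).den : ℝ) := by
        rw [hND]
        exact_mod_cast h1
      exact h2.trans (mul_le_mul_of_nonneg_left
        (prod_submatrix_le hf Subtype.val_injective hden) (abs_nonneg _))
    have hD : 0 ≤ ∏ i, ∏ j, ((A i j).den : ℝ) := by positivity
    calc v j = 1 * v j := (one_mul _).symm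
      _ ≤ (|N.det| * ∏ i, ∏ j, ((A i j).den : ℝ)) * v j :=
        mul_le_mul_of_nonneg_right hdenom (hv0 j)
      _ = (∏ i, ∏ j, ((A i j).den : ℝ)) * |N.det * v j| := by
        rw [abs_mul, abs_of_nonneg (hv0 j)]; ring
      _ ≤ P := by
        rw [hcramer]
        exact mul_le_mul_of_nonneg_left hnum hD
  have hPlt : P < 2 ^ bitSize A := prod_den_mul_one_add_abs_lt A
  have hP0 : 0 < P := by linarith
  -- All entries before scaling are at most `P`, and entry `i` is `1`; it becomes `1/P > 2^(-L)`.
  refine ⟨P⁻¹ • (v + Pi.single i 1), ?_, ?_, ?_⟩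
  · rw [Matrix.mulVec_smul, Matrix.mulVec_add, Matrix.mulVec_single_one, hv, neg_add_cancel,
      smul_zero]
  · intro j
    have hj : 0 ≤ (v + Pi.single i 1 : Fin n → ℝ) j ∧
        (v + Pi.single i 1 : Fin n → ℝ) j ≤ P := by
      by_cases h : j = i
      · subst h; simpa [hvi] using hP1
      · simpa [h] using ⟨hv0 j, hvP j⟩
    rw [Pi.smul_apply, smul_eq_mul, inv_mul_le_iff₀ hP0, mul_one]
    exact ⟨mul_nonneg (inv_nonneg.2 hP0.le) hj.1, hj.2⟩
  · simp only [Pi.smul_apply, Pi.add_apply, hvi, Pi.single_eq_same, zero_add, smul_eq_mul, mul_one]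
    rw [one_div]
    exact inv_strictAnti₀ hP0 hPlt

end BitSize

/-! ### The basic procedure -/

section BasicProcedure

variable {n : ℕ}

/-- The bound that `v` gives for coordinate `j` of the null vectors in the unit cube. -/
noncomputable def cutBound (v : Fin n → ℝ) (j : Fin n) : ℝ := ∑ i, max 0 (v i / -v j)

/-- Divide `v ⬝ᵥ x = 0` by `-v j` and solve for `x j`; then drop the negative coefficients and use
`x i ≤ 1` in the other terms. -/
theorem le_cutBound {v x : Fin n → ℝ} (hvx : v ⬝ᵥ x = 0) (hx : ∀ i, 0 ≤ x i ∧ x i ≤ 1) {j : Fin n}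
    (hj : v j ≠ 0) : x j ≤ cutBound v j := by
  have h0 : ∑ i, v i / -v j * x i = 0 := by
    have : ∑ i, v i / -v j * x i = (v ⬝ᵥ x) / -v j := by
      rw [dotProduct, Finset.sum_div]
      exact Finset.sum_congr rfl fun i _ => by ring
    rw [this, hvx, zero_div]
  have h1 : x j = ∑ i, (v i / -v j * x i + if i = j then x j else 0) := by
    rw [Finset.sum_add_distrib, h0, zero_add, Finset.sum_ite_eq' Finset.univ j]
    simp
  rw [h1]
  refine Finset.sum_le_sum fun i _ => ?_
  by_cases hij : i = j
  · subst hij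
    rw [if_pos rfl, div_neg, div_self hj]
    simp
  · rw [if_neg hij, add_zero]
    calc v i / -v j * x i ≤ max 0 (v i / -v j) * x i :=
          mul_le_mul_of_nonneg_right (le_max_right _ _) (hx i).1
      _ ≤ max 0 (v i / -v j) := mul_le_of_le_one_right (le_max_left _ _) (hx i).2

theorem within_cutTest {I : List (Fin n)} (hI : I.Nodup) {v : Fin n → ℝ} (hv : SupportedOn I v)
    (j : Fin n) :
    Within (cutTest I v j) (decide (v j ≠ 0 ∧ cutBound v j ≤ 1 / 2)) (I.length * 3 + 3) := by
  have hfold : Within (I.foldlM (fun s i => (do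
      let q ← div (v i) (0 - v j)
      let neg ← le q 0
      add s (if neg then 0 else q) : Comp ℝ)) 0) (cutBound v j) (I.length * 3) := by
    have := within_foldlM (f := fun (s : ℝ) (i : Fin n) => (do
      let q ← div (v i) (0 - v j)
      let neg ← le q 0
      add s (if neg then 0 else q) : Comp ℝ))
      (g := fun s i => s + max 0 (v i / -v j)) (k := 3) I 0 fun s i _ => by
        have h : (if decide (v i / (0 - v j) ≤ 0) = true then 0 else v i / (0 - v j)) =
            max 0 (v i / -v j) := by
          rw [zero_sub]
          by_cases h : v i / -v j ≤ 0
          · rw [if_pos (decide_eq_true h), max_eq_left h]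
          · rw [if_neg (by simpa using h), max_eq_right (le_of_not_ge h)]
        rw [← h]
        exact Within.mono (Within.bind (within_div _ _) (Within.bind (within_le _ _)
          (within_add _ _))) le_rfl
    rwa [foldl_add_eq_sum hI fun i hi => by rw [hv i hi, zero_div, max_self]] at this
  unfold cutTest
  refine Within.mono (Within.bind (within_eq _ _) (t := I.length * 3 + 2) ?_) (by omega)
  by_cases hj : v j = 0
  · rw [if_pos (decide_eq_true hj)]
    simpa [hj] using (within_pure false).mono (Nat.zero_le _)
  · rw [if_neg (by simpa using hj)]
    have : decide (v j ≠ 0 ∧ cutBound v j ≤ 1 / 2) = decide (cutBound v j ≤ 1 / 2) := by simp [hj]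
    rw [this]
    exact Within.mono (Within.bind (within_sub _ _) (Within.bind hfold (within_le _ _))) (by omega)

/-- The indicator vector of the nonpositive coordinates of `v` in `I`. -/
noncomputable def nonposIndicator (I : List (Fin n)) (v : Fin n → ℝ) : Fin n → ℝ :=
  restrictTo (I.filter fun k => decide (v k ≤ 0)) fun _ => 1

theorem nonposIndicator_apply (I : List (Fin n)) (v : Fin n → ℝ) (i : Fin n) :
    nonposIndicator I v i = if i ∈ I ∧ v i ≤ 0 then 1 else 0 := by
  simp [nonposIndicator, restrictTo]

theorem supportedOn_nonposIndicator (I : List (Fin n)) (v : Fin n → ℝ) :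
    SupportedOn I (nonposIndicator I v) := fun i hi => by
  rw [nonposIndicator_apply, if_neg fun h => hi h.1]

theorem sum_indicator_mem {I : List (Fin n)} (hI : I.Nodup) (a : ℝ) :
    ∑ i, (if i ∈ I then a else 0) = I.length * a := by
  rw [← Finset.sum_filter, Finset.sum_const, nsmul_eq_mul]
  congr 2
  have : (Finset.univ.filter fun i => i ∈ I) = I.toFinset := by ext; simp
  rw [this, List.toFinset_card_of_nodup hI]

theorem nonposIndicator_dotProduct_self_le {I : List (Fin n)} (hI : I.Nodup) (v : Fin n → ℝ) :
    nonposIndicator I v ⬝ᵥ nonposIndicator I v ≤ I.length := by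
  rw [← mul_one (I.length : ℝ), ← sum_indicator_mem hI]
  refine Finset.sum_le_sum fun i _ => ?_
  rw [nonposIndicator_apply]
  split_ifs <;> simp_all

/-- The normalised inner product of `q` and `v`, with value `0` for `q = 0`. -/
noncomputable def normalizedInner (q v : Fin n → ℝ) : ℝ :=
  if Real.sqrt (q ⬝ᵥ q) = 0 then 0 else q ⬝ᵥ v / Real.sqrt (q ⬝ᵥ q)

/-- This product form also covers `q = 0`, where both sides vanish. -/
theorem normalizedInner_mul_sqrt (q v : Fin n → ℝ) :
    normalizedInner q v * Real.sqrt (q ⬝ᵥ q) = q ⬝ᵥ v := by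
  unfold normalizedInner
  split_ifs with h
  · rw [Real.sqrt_eq_zero (dotProduct_self_nonneg_real q), dotProduct_self_eq_zero] at h
    simp [h]
  · exact div_mul_cancel₀ _ h

/-- The threshold `1 / (2 r^(3/2))`. -/
noncomputable def bpThreshold (r : ℝ) : ℝ := 1 / (2 * (r * Real.sqrt r))

theorem bpThreshold_mul_sqrt {r : ℝ} (hr : 0 < r) : bpThreshold r * Real.sqrt r = 1 / (2 * r) := by
  have := Real.sqrt_pos.2 hr
  unfold bpThreshold
  field_simp

theorem bpThreshold_sq {r : ℝ} (hr : 0 < r) : bpThreshold r ^ 2 = 1 / (4 * r ^ 3) := by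
  rw [bpThreshold, div_pow, mul_pow, mul_pow, Real.sq_sqrt hr.le]
  congr 1 <;> ring

theorem bpThreshold_pos {r : ℝ} (hr : 0 < r) : 0 < bpThreshold r := by
  have := Real.sqrt_pos.2 hr
  unfold bpThreshold
  positivity

variable {I : List (Fin n)} {W : List (Fin n → ℝ)}

/-- If neither case 1 nor a further update applies, then some coordinate can be cut. -/
theorem exists_cutBound_le (hI : I.Nodup) (hW : IsOrthogonalList I W) {y v : Fin n → ℝ}
    (hv : v ∈ listSpan W) (hy : ∀ i ∈ I, 1 / (I.length : ℝ) ≤ y i) {j : Fin n} (hjI : j ∈ I)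
    (hj : y j - v j ≤ 0)
    (hα : -bpThreshold I.length < normalizedInner (orthProj W (nonposIndicator I v)) v) :
    v j ≠ 0 ∧ cutBound v j ≤ 1 / 2 := by
  set e := nonposIndicator I v with he
  set q := orthProj W e with hq
  have hr : (0 : ℝ) < I.length := by
    exact_mod_cast List.length_pos_of_mem hjI
  have hvj : 1 / (I.length : ℝ) ≤ v j := by linarith [hy j hjI]
  have hvj0 : 0 < v j := lt_of_lt_of_le (by positivity) hvj
  refine ⟨hvj0.ne', ?_⟩
  have hev : e ⬝ᵥ v = q ⬝ᵥ v := by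
    rw [hq, hW.orthProj_dotProduct, hW.orthProj_of_mem hv]
  have hlen : Real.sqrt (q ⬝ᵥ q) ≤ Real.sqrt I.length :=
    Real.sqrt_le_sqrt ((hW.orthProj_dotProduct_self_le e).trans
      (nonposIndicator_dotProduct_self_le hI v))
  -- The left side is the total negative part of `v`. The exponent `3/2` in the threshold is chosen
  -- to absorb `‖q‖ ≤ √r`.
  have hneg : -(e ⬝ᵥ v) ≤ 1 / (2 * I.length) := by
    rw [hev, ← normalizedInner_mul_sqrt, ← bpThreshold_mul_sqrt hr, ← neg_mul]
    calc -normalizedInner q v * Real.sqrt (q ⬝ᵥ q)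
        ≤ bpThreshold I.length * Real.sqrt (q ⬝ᵥ q) :=
          mul_le_mul_of_nonneg_right (by linarith) (Real.sqrt_nonneg _)
      _ ≤ _ := mul_le_mul_of_nonneg_left hlen (bpThreshold_pos hr).le
  -- As `v j > 0`, exactly the nonpositive entries of `v` contribute to the bound.
  have hbound : cutBound v j = -(e ⬝ᵥ v) / v j := by
    rw [cutBound, dotProduct, ← Finset.sum_neg_distrib, Finset.sum_div]
    refine Finset.sum_congr rfl fun i _ => ?_
    rw [he, nonposIndicator_apply]
    by_cases hi : i ∈ I
    · rcases le_or_gt (v i) 0 with h | h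
      · rw [if_pos ⟨hi, h⟩, one_mul, div_neg, ← neg_div]
        exact max_eq_right (div_nonneg (by linarith) hvj0.le)
      · rw [if_neg fun h' => absurd h'.2 (not_le.2 h), zero_mul, neg_zero, zero_div, div_neg]
        exact max_eq_left (neg_nonpos.2 (div_nonneg h.le hvj0.le))
    · rw [hW.supportedOn_of_mem_span hv i hi]
      simp
  rw [hbound, div_le_iff₀ hvj0]
  calc -(e ⬝ᵥ v) ≤ 1 / (2 * I.length) := hneg
    _ = 1 / 2 * (1 / I.length) := by rw [one_div_mul_one_div]
    _ ≤ 1 / 2 * v j := by linarith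

/-- An update decreases `‖v‖²` by at least `c (2 - c)` times the squared threshold. -/
theorem update_dotProduct_self_le {c thr : ℝ} (hc0 : 0 < c) (hc2 : c < 2) (hthr : 0 < thr)
    {q v : Fin n → ℝ} (hα : normalizedInner q v ≤ -thr) :
    (v - (c * (normalizedInner q v / Real.sqrt (q ⬝ᵥ q))) • q) ⬝ᵥ
      (v - (c * (normalizedInner q v / Real.sqrt (q ⬝ᵥ q))) • q) + c * (2 - c) * thr ^ 2 ≤
      v ⬝ᵥ v := by
  have h1 := normalizedInner_mul_sqrt q v
  have h2 := Real.sq_sqrt (dotProduct_self_nonneg_real q)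
  -- The default value `0` for `q = 0` lies above `-thr`, so an update never divides by zero.
  have hs : Real.sqrt (q ⬝ᵥ q) ≠ 0 := by
    intro h
    rw [normalizedInner, if_pos h] at hα
    linarith
  set α := normalizedInner q v
  set s := Real.sqrt (q ⬝ᵥ q)
  -- The cross term contributes `-2 c α²` and the square `c² α²`; the gain is positive precisely for
  -- `0 < c < 2`.
  have hexp : (v - (c * (α / s)) • q) ⬝ᵥ (v - (c * (α / s)) • q) =
      v ⬝ᵥ v - c * (2 - c) * α ^ 2 := by
    rw [sub_dotProduct, dotProduct_sub, dotProduct_sub, smul_dotProduct, smul_dotProduct,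
      dotProduct_smul, dotProduct_smul, dotProduct_comm v q, ← h1, ← h2]
    simp only [smul_eq_mul]
    field_simp
    ring
  have hsq : thr ^ 2 ≤ α ^ 2 := by nlinarith
  have hcc : 0 < c * (2 - c) := mul_pos hc0 (by linarith)
  rw [hexp]
  nlinarith

/-- What the result of the basic procedure guarantees, for the row space `S` on the
coordinates `I`. -/
def BPResult.IsValid (I : List (Fin n)) (S : Submodule ℝ (Fin n → ℝ)) : BPResult n → Prop
  | .primal z => SupportedOn I z ∧ (∀ i ∈ I, 0 < z i) ∧ ∀ s ∈ S, s ⬝ᵥ z = 0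
  | .dual v => I.length = n ∧ v ∈ S ∧ ∀ i ∈ I, 0 < v i
  | .cut J => J ≠ [] ∧ J.Sublist I ∧ ∃ v ∈ S, ∀ j ∈ J, v j ≠ 0 ∧ cutBound v j ≤ 1 / 2

/-- The bound on the number of updates. -/
noncomputable def bpUpdateBound (c : ℝ) (r : ℕ) : ℕ := ⌈4 / (c * (2 - c))⌉₊ * r ^ 2

/-- The invariant of the basic procedure. -/
structure BPInvariant (c : ℝ) (I : List (Fin n)) (W : List (Fin n → ℝ))
    (s : (Fin n → ℝ) × (Fin n → ℝ) × ℕ) : Prop where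
  supported : SupportedOn I s.1
  le_y : ∀ i ∈ I, 1 / (I.length : ℝ) ≤ s.1 i
  v_eq : s.2.1 = orthProj W s.1
  potential : s.2.1 ⬝ᵥ s.2.1 + s.2.2 * (c * (2 - c) * bpThreshold I.length ^ 2) ≤
    1 / (I.length : ℝ)
  updates : s.2.2 ≤ bpUpdateBound c I.length

/-- The budget `1/r` divided by the gain `c (2 - c) / (4 r³)` per update is `4 r² / (c (2 - c))`. -/
theorem le_bpUpdateBound {c : ℝ} (hc0 : 0 < c) (hc2 : c < 2) {r t : ℕ} (hr : 0 < r)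
    (h : (t : ℝ) * (c * (2 - c) * bpThreshold r ^ 2) ≤ 1 / (r : ℝ)) : t ≤ bpUpdateBound c r := by
  have hr' : (0 : ℝ) < r := by exact_mod_cast hr
  have hcc : 0 < c * (2 - c) := mul_pos hc0 (by linarith)
  rw [bpThreshold_sq hr'] at h
  have h1 : (t : ℝ) * (c * (2 - c)) ≤ 4 * (r : ℝ) ^ 2 := by
    have h2 := mul_le_mul_of_nonneg_right h (show (0 : ℝ) ≤ 4 * (r : ℝ) ^ 3 by positivity)
    have h3 : (t : ℝ) * (c * (2 - c) * (1 / (4 * (r : ℝ) ^ 3))) * (4 * (r : ℝ) ^ 3) =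
        t * (c * (2 - c)) := by field_simp
    have h4 : 1 / (r : ℝ) * (4 * (r : ℝ) ^ 3) = 4 * (r : ℝ) ^ 2 := by field_simp
    rwa [h3, h4] at h2
  have h2 : (t : ℝ) ≤ 4 / (c * (2 - c)) * (r : ℝ) ^ 2 := by
    rw [div_mul_eq_mul_div, le_div_iff₀ hcc]
    exact h1
  have h3 : (t : ℝ) ≤ (⌈4 / (c * (2 - c))⌉₊ : ℝ) * (r : ℝ) ^ 2 :=
    h2.trans (mul_le_mul_of_nonneg_right (Nat.le_ceil _) (by positivity))
  unfold bpUpdateBound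
  exact_mod_cast h3

/-- One pass of the basic procedure. -/
theorem bpBody_spec {c : ℝ} (hc0 : 0 < c) (hc2 : c < 2) (hI : I.Nodup)
    (hW : IsOrthogonalList I W) {pick : List (Fin n) → List (Fin n)}
    (hpick : ∀ B, B ≠ [] → pick B ≠ [] ∧ (pick B).Sublist B)
    (s : (Fin n → ℝ) × (Fin n → ℝ) × ℕ) (hs : BPInvariant c I W s) :
    (∃ b : BPResult n × ℕ, (b.1.IsValid I (listSpan W) ∧ b.2 ≤ bpUpdateBound c I.length) ∧
      Within (bpBody c I W pick I.length (bpThreshold I.length) s) (Sum.inl b)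
        (I.length * I.length * 3 + I.length * 18 + W.length * (I.length * 7 + 1) + 8)) ∨
    ∃ s', BPInvariant c I W s' ∧
      bpUpdateBound c I.length - s'.2.2 < bpUpdateBound c I.length - s.2.2 ∧
      Within (bpBody c I W pick I.length (bpThreshold I.length) s) (Sum.inr s')
        (I.length * 18 + W.length * (I.length * 7 + 1) + 8) := by
  obtain ⟨y, v, t⟩ := s
  obtain ⟨hy, hyr, hvy, hpot, hupd⟩ := hs
  dsimp only at hy hyr hvy hpot hupd
  have hvS : v ∈ listSpan W := hvy ▸ orthProj_mem W y
  have hvI : SupportedOn I v := hW.supportedOn_of_mem_span hvS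
  have hz : restrictTo I (fun i => y i - v i) = y - v :=
    SupportedOn.restrictTo_eq (x := y - v) fun i hi => by simp [hy i hi, hvI i hi]
  unfold bpBody
  dsimp only
  -- With no columns left this holds vacuously, so `r > 0` in all later cases that use the
  -- threshold.
  by_cases hzpos : ∀ i ∈ I, 0 < restrictTo I (fun i => y i - v i) i
  · refine Or.inl ⟨(BPResult.primal (restrictTo I (fun i => y i - v i)), t),
      ⟨⟨supportedOn_restrictTo _ _, hzpos, fun x hx => ?_⟩, hupd⟩, ?_⟩
    · rw [hz, dotProduct_sub, hvy, hW.dotProduct_orthProj hx, sub_self]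
    · refine Within.mono (Within.bind (within_tabulate fun i _ => within_sub _ _)
        (Within.bind (within_allPos _ _) (Within.bind (within_allPos _ _)
          (Within.bind (within_eq _ _) (t := 0) ?_)))) ?_
      · rw [if_pos (decide_eq_true hzpos)]
        exact within_pure _
      · omega
  by_cases hdual : (∀ i ∈ I, 0 < v i) ∧ (I.length : ℝ) = n
  · refine Or.inl ⟨(BPResult.dual v, t), ⟨⟨by exact_mod_cast hdual.2, hvS, hdual.1⟩, hupd⟩, ?_⟩
    refine Within.mono (Within.bind (within_tabulate fun i _ => within_sub _ _)
      (Within.bind (within_allPos _ _) (Within.bind (within_allPos _ _)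
        (Within.bind (within_eq _ _) (t := 0) ?_)))) ?_
    · rw [if_neg (by simpa using hzpos), if_pos (by simpa using hdual)]
      exact within_pure _
    · omega
  obtain ⟨j, hjI, hj⟩ : ∃ j ∈ I, y j - v j ≤ 0 := by
    push Not at hzpos
    obtain ⟨j, hjI, hj⟩ := hzpos
    rw [restrictTo_apply_of_mem hjI] at hj
    exact ⟨j, hjI, hj⟩
  have hr0 : 0 < I.length := List.length_pos_of_mem hjI
  have hr : (0 : ℝ) < I.length := by exact_mod_cast hr0
  set e := nonposIndicator I v with he
  set q := orthProj W e with hq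
  have hqI : SupportedOn I q := hW.supportedOn_of_mem_span (orthProj_mem W e)
  have hKlen : (I.filter fun k => decide (v k ≤ 0)).length ≤ I.length := List.length_filter_le _ _
  have hαw : Within (if decide (Real.sqrt (q ⬝ᵥ q) = 0) = true then pure 0
      else div (q ⬝ᵥ v) (Real.sqrt (q ⬝ᵥ q))) (normalizedInner q v) 1 := by
    unfold normalizedInner
    by_cases h : Real.sqrt (q ⬝ᵥ q) = 0
    · rw [if_pos (decide_eq_true h), if_pos h]
      exact (within_pure _).mono zero_le_one
    · rw [if_neg (by simpa using h), if_neg h]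
      exact within_div _ _
  by_cases hα : normalizedInner q v ≤ -bpThreshold I.length
  · set b := c * (normalizedInner q v / Real.sqrt (q ⬝ᵥ q)) with hb
    have hb0 : b ≤ 0 := mul_nonpos_of_nonneg_of_nonpos hc0.le
      (div_nonpos_of_nonpos_of_nonneg (by linarith [bpThreshold_pos hr]) (Real.sqrt_nonneg _))
    have hy' : restrictTo I (fun i => y i - b * e i) = y - b • e :=
      SupportedOn.restrictTo_eq (x := y - b • e) fun i hi => by
        simp [hy i hi, supportedOn_nonposIndicator I v i hi, he]
    have hv' : restrictTo I (fun i => v i - b * q i) = v - b • q :=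
      SupportedOn.restrictTo_eq (x := v - b • q) fun i hi => by simp [hvI i hi, hqI i hi]
    have hpot' : (v - b • q) ⬝ᵥ (v - b • q) +
        ((t + 1 : ℕ) : ℝ) * (c * (2 - c) * bpThreshold I.length ^ 2) ≤ 1 / (I.length : ℝ) := by
      have := update_dotProduct_self_le hc0 hc2 (bpThreshold_pos hr) hα
      push_cast
      linarith
    -- The new squared norm is nonnegative, so the potential inequality alone bounds the number of
    -- updates.
    have hupd' : t + 1 ≤ bpUpdateBound c I.length :=
      le_bpUpdateBound hc0 hc2 hr0 (by linarith [dotProduct_self_nonneg_real (v - b • q)])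
    refine Or.inr ⟨(y - b • e, v - b • q, t + 1), ⟨?_, ?_, ?_, hpot', hupd'⟩, ?_, ?_⟩
    · rw [← hy']
      exact supportedOn_restrictTo _ _
    · intro i hi
      have he0 : 0 ≤ e i := by rw [he, nonposIndicator_apply]; split_ifs <;> simp
      have := mul_nonneg (neg_nonneg.2 hb0) he0
      have := hyr i hi
      show _ ≤ y i - b * e i
      linarith
    · show v - b • q = orthProj W (y - b • e)
      rw [orthProj_sub, orthProj_smul, ← hvy]
    · dsimp only
      omega
    · rw [← hy', ← hv']
      refine Within.mono (Within.bind (within_tabulate fun i _ => within_sub _ _)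
        (Within.bind (within_allPos _ _) (Within.bind (within_allPos _ _)
          (Within.bind (within_eq _ _)
            (t := I.length * 14 + W.length * (I.length * 7 + 1) + 7) ?_)))) (by omega)
      rw [if_neg (by simpa using hzpos), if_neg (by simpa using hdual)]
      refine Within.mono (Within.bind (within_select I fun k _ => within_le _ _)
        (Within.bind (within_tabulate fun i _ => within_pure _)
        (Within.bind (within_project hI hW.supported _)
        (Within.bind (within_dot hI hqI _)
        (Within.bind (within_sqrt _)
        (Within.bind (within_dot hI hqI _)
        (Within.bind (within_eq _ _)
        (Within.bind hαw
        (Within.bind (within_sub _ _)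
        (Within.bind (within_le _ _) (t := I.length * 6 + 2) ?_)))))))))) ?_
      · rw [if_pos (decide_eq_true (by simpa using hα))]
        exact Within.mono (Within.bind (within_div _ _) (Within.bind (within_mul _ _)
          (Within.bind (within_tabulate fun i _ => Within.bind (within_mul _ _) (within_sub _ _))
          (Within.bind (within_tabulate fun i _ => Within.bind (within_mul _ _) (within_sub _ _))
          (within_pure _))))) (by omega)
      · omega
  · left
    have hcut := exists_cutBound_le hI hW hvS hyr hjI hj (not_le.1 hα)
    set B := I.filter fun j => decide (v j ≠ 0 ∧ cutBound v j ≤ 1 / 2) with hB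
    have hjB : j ∈ B := List.mem_filter.2 ⟨hjI, decide_eq_true hcut⟩
    obtain ⟨hne, hsub⟩ := hpick B (List.ne_nil_of_mem hjB)
    have hBlen : B.length ≤ I.length := List.length_filter_le _ _
    refine ⟨(BPResult.cut (pick B), t), ⟨⟨hne, hsub.trans List.filter_sublist, v, hvS,
      fun k hk => of_decide_eq_true (List.mem_filter.1 (hsub.subset hk)).2⟩, hupd⟩, ?_⟩
    refine Within.mono (Within.bind (within_tabulate fun i _ => within_sub _ _)
      (Within.bind (within_allPos _ _) (Within.bind (within_allPos _ _)
        (Within.bind (within_eq _ _)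
          (t := I.length * I.length * 3 + I.length * 13 + W.length * (I.length * 7 + 1) + 5) ?_))))
        (by omega)
    rw [if_neg (by simpa using hzpos), if_neg (by simpa using hdual)]
    refine Within.mono (Within.bind (within_select I fun k _ => within_le _ _)
      (Within.bind (within_tabulate fun i _ => within_pure _)
      (Within.bind (within_project hI hW.supported _)
      (Within.bind (within_dot hI hqI _)
      (Within.bind (within_sqrt _)
      (Within.bind (within_dot hI hqI _)
      (Within.bind (within_eq _ _)
      (Within.bind hαw
      (Within.bind (within_sub _ _)
      (Within.bind (within_le _ _) (t := I.length * I.length * 3 + I.length * 5) ?_)))))))))) ?_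
    · rw [if_neg (by simpa using hα)]
      refine Within.mono (Within.bind (within_select I fun k _ => within_cutTest hI hvI k)
        (Within.bind (within_tick _) (within_pure _))) ?_
      rw [← hB]
      nlinarith
    · omega

/-- The basic procedure. -/
theorem basicProcedure_spec {c : ℝ} (hc0 : 0 < c) (hc2 : c < 2) (hI : I.Nodup)
    (hW : IsOrthogonalList I W) {pick : List (Fin n) → List (Fin n)}
    (hpick : ∀ B, B ≠ [] → pick B ≠ [] ∧ (pick B).Sublist B) :
    ∃ b : BPResult n × ℕ, b.1.IsValid I (listSpan W) ∧ b.2 ≤ bpUpdateBound c I.length ∧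
      Within (basicProcedure c I W pick) b
        (bpUpdateBound c I.length * (I.length * 18 + W.length * (I.length * 7 + 1) + 8 + 1) +
          (I.length * I.length * 3 + I.length * 22 + W.length * (I.length * 7 + 1) * 2 + 13)) := by
  set y := restrictTo I (fun _ => 1 / (I.length : ℝ)) with hy
  have hyy : y ⬝ᵥ y ≤ 1 / (I.length : ℝ) := by
    have h : y ⬝ᵥ y = ∑ i, if i ∈ I then 1 / (I.length : ℝ) * (1 / (I.length : ℝ)) else 0 := by
      refine Finset.sum_congr rfl fun i _ => ?_
      by_cases hi : i ∈ I <;> simp [hy, restrictTo, hi]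
    rw [h, sum_indicator_mem hI]
    -- Without columns both sides are `0`, by the convention `1 / 0 = 0`.
    rcases Nat.eq_zero_or_pos I.length with h0 | h0
    · simp [h0]
    · have : (I.length : ℝ) ≠ 0 := by exact_mod_cast h0.ne'
      rw [← mul_assoc, mul_one_div_cancel this, one_mul]
  have hinv : BPInvariant c I W (y, orthProj W y, 0) := by
    refine ⟨supportedOn_restrictTo _ _, fun i hi => ?_, rfl, ?_, Nat.zero_le _⟩
    · show 1 / (I.length : ℝ) ≤ y i
      rw [hy, restrictTo_apply_of_mem hi]
    · simpa using (hW.orthProj_dotProduct_self_le y).trans (by simpa using hyy)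
  obtain ⟨b, ⟨hb, hb'⟩, hw⟩ := within_loop (BPInvariant c I W)
    (fun b : BPResult n × ℕ => b.1.IsValid I (listSpan W) ∧ b.2 ≤ bpUpdateBound c I.length)
    (fun s => bpUpdateBound c I.length - s.2.2) _ _
    (bpBody_spec hc0 hc2 hI hW hpick) _ hinv
  refine ⟨b, hb, hb', ?_⟩
  unfold basicProcedure
  refine Within.mono (Within.bind (within_count I) (Within.bind (within_sqrt _)
    (Within.bind (within_mul _ _) (Within.bind (within_mul _ _) (Within.bind (within_div _ _)
    (Within.bind (within_tabulate fun i _ => within_div _ _)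
    (Within.bind (within_project hI hW.supported _) hw))))))) ?_
  dsimp only
  rw [Nat.sub_zero]
  omega

end BasicProcedure

/-! ### The main algorithm -/

section MainAlgorithm

variable {m n : ℕ}

/-- The null vectors of `A` in the unit cube. -/
def IsCubeSolution (A : Matrix (Fin m) (Fin n) ℝ) (x : Fin n → ℝ) : Prop :=
  A *ᵥ x = 0 ∧ ∀ j, 0 ≤ x j ∧ x j ≤ 1

/-- A nonnegative null vector can be scaled into the unit cube. -/
theorem exists_isCubeSolution_smul {A : Matrix (Fin m) (Fin n) ℝ} {x : Fin n → ℝ}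
    (hA : A *ᵥ x = 0) (hx : ∀ j, 0 ≤ x j) : ∃ t : ℝ, 0 < t ∧ IsCubeSolution A (t • x) := by
  have hs : 0 ≤ ∑ j, x j := Finset.sum_nonneg fun j _ => hx j
  refine ⟨(1 + ∑ j, x j)⁻¹, by positivity, by rw [Matrix.mulVec_smul, hA, smul_zero], fun j => ?_⟩
  have hj : x j ≤ ∑ j, x j := Finset.single_le_sum (fun j _ => hx j) (Finset.mem_univ j)
  rw [Pi.smul_apply, smul_eq_mul, inv_mul_le_iff₀ (by linarith)]
  exact ⟨mul_nonneg (by positivity) (hx j), by linarith⟩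

/-- The invariant of the main algorithm; `N` and `T` bound the updates and the time of each call
of the basic procedure. -/
structure MAInvariant (A : Matrix (Fin m) (Fin n) ℝ) (L N T : ℕ) (s : MAState m n) : Prop where
  nodup : s.I.Nodup
  scaling : ∃ e : Fin n → ℕ, (∀ j, e j ≤ L) ∧ (∀ j ∈ s.I, e j < L ∧ s.d j = (1 / 2) ^ e j) ∧
    s.rescalings ≤ ∑ j, e j
  d_eq_zero : SupportedOn s.I s.d
  matrix : ∀ i, ∀ j ∈ s.I, s.M i j = A i j * s.d j
  le_d : ∀ x, IsCubeSolution A x → ∀ j, x j ≤ s.d j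
  length_calls : s.calls.length = s.rescalings
  calls : ∀ b ∈ s.calls, b.iterations ≤ N ∧ b.time ≤ T

/-- What the final report guarantees. -/
structure Report.IsValid (A : Matrix (Fin m) (Fin n) ℝ) (L N T : ℕ) (R : Report n) : Prop where
  solves : R.outcome.Solves A
  rescalings : R.rescalings ≤ n * L
  length_calls : R.calls.length = R.rescalings + 1
  calls : ∀ b ∈ R.calls, b.iterations ≤ N ∧ b.time ≤ T

namespace MAInvariant

variable {A : Matrix (Fin m) (Fin n) ℝ} {L N T : ℕ} {s : MAState m n}

theorem rescalings_le (h : MAInvariant A L N T s) : s.rescalings ≤ n * L := by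
  obtain ⟨e, he, -, hsum⟩ := h.scaling
  refine hsum.trans ((Finset.sum_le_sum fun j _ => he j).trans ?_)
  simp

theorem d_pos (h : MAInvariant A L N T s) {j : Fin n} (hj : j ∈ s.I) : 0 < s.d j := by
  obtain ⟨e, -, he, -⟩ := h.scaling
  rw [(he j hj).2]
  positivity

theorem d_nonneg (h : MAInvariant A L N T s) (j : Fin n) : 0 ≤ s.d j := by
  by_cases hj : j ∈ s.I
  · exact (h.d_pos hj).le
  · exact (h.d_eq_zero j hj).ge

theorem mulVec_eq (h : MAInvariant A L N T s) {x : Fin n → ℝ} (hx : SupportedOn s.I x) :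
    s.M *ᵥ x = A *ᵥ fun j => s.d j * x j := by
  funext i
  show ∑ j, s.M i j * x j = ∑ j, A i j * (s.d j * x j)
  refine Finset.sum_congr rfl fun j _ => ?_
  by_cases hj : j ∈ s.I
  · rw [h.matrix i j hj, mul_assoc]
  · rw [hx j hj]; ring

/-- Deleted columns carry no solution: after scaling `x` into the cube, its entry is at most `d j =
0`. -/
theorem eq_zero_of_notMem (h : MAInvariant A L N T s) {x : Fin n → ℝ} (hA : A *ᵥ x = 0)
    (hx : ∀ j, 0 ≤ x j) {j : Fin n} (hj : j ∉ s.I) : x j = 0 := by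
  obtain ⟨t, ht, hcube⟩ := exists_isCubeSolution_smul hA hx
  have h1 := h.le_d _ hcube j
  rw [h.d_eq_zero j hj, Pi.smul_apply, smul_eq_mul] at h1
  exact le_antisymm (nonpos_of_mul_nonpos_right h1 ht) (hx j)

/-- The result in case 1 is correct. -/
theorem solves_primal (h : MAInvariant A L N T s) {z : Fin n → ℝ} (hzI : SupportedOn s.I z)
    (hz : ∀ i ∈ s.I, 0 < z i) (horth : ∀ r ∈ rowSpace s.I s.M, r ⬝ᵥ z = 0) :
    (Outcome.primal (restrictTo s.I fun i => s.d i * z i)).Solves A := by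
  have hx : restrictTo s.I (fun i => s.d i * z i) = fun i => s.d i * z i :=
    SupportedOn.restrictTo_eq fun i hi => by rw [hzI i hi, mul_zero]
  rw [hx]
  have hA : A *ᵥ (fun i => s.d i * z i) = 0 := by
    rw [← h.mulVec_eq hzI]
    exact mulVec_eq_zero_of_orthogonal hzI horth
  have hpos : ∀ j ∈ s.I, 0 < s.d j * z j := fun j hj => mul_pos (h.d_pos hj) (hz j hj)
  rcases List.eq_nil_or_concat s.I with hI | ⟨l, k, hI⟩
  · refine Or.inr ⟨?_, ?_⟩
    · funext j
      rw [hzI j (by simp [hI]), mul_zero]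
      rfl
    · rintro ⟨x, hAx, hx0, hne⟩
      exact hne (funext fun j => h.eq_zero_of_notMem hAx hx0 (by simp [hI]))
  · have hk : k ∈ s.I := by simp [hI]
    refine Or.inl ⟨⟨hA, fun j => ?_, fun h0 => (hpos k hk).ne' (congrFun h0 k)⟩, ?_⟩
    · by_cases hj : j ∈ s.I
      · exact (hpos j hj).le
      · show 0 ≤ s.d j * z j
        rw [hzI j hj, mul_zero]
    · rintro x ⟨hAx, hx0, -⟩ j (hj : 0 < x j)
      by_contra hjI
      by_cases hmem : j ∈ s.I
      · exact hjI (hpos j hmem)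
      · exact hj.ne' (h.eq_zero_of_notMem hAx hx0 hmem)

/-- The result in case 2 is correct. -/
theorem solves_dual (h : MAInvariant A L N T s) {v : Fin n → ℝ} (hlen : s.I.length = n)
    (hv : v ∈ rowSpace s.I s.M) (hpos : ∀ i ∈ s.I, 0 < v i) :
    (Outcome.dual s.d v).Solves A := by
  have hmem : ∀ j, j ∈ s.I := by
    intro j
    have hcard : s.I.toFinset.card = Fintype.card (Fin n) := by
      rw [List.toFinset_card_of_nodup h.nodup, hlen, Fintype.card_fin]
    have := (Finset.card_eq_iff_eq_univ _).1 hcard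
    exact List.mem_toFinset.1 (this ▸ Finset.mem_univ j)
  obtain ⟨u, rfl⟩ := exists_of_mem_rowSpace hv
  have hvj : ∀ j, restrictTo s.I (u ᵥ* s.M) j = s.d j * (Aᵀ *ᵥ u) j := by
    intro j
    rw [restrictTo_apply_of_mem (hmem j), Matrix.mulVec_transpose]
    show ∑ i, u i * s.M i j = s.d j * ∑ i, u i * A i j
    rw [Finset.mul_sum]
    exact Finset.sum_congr rfl fun i _ => by rw [h.matrix i j (hmem j)]; ring
  have hupos : ∀ j, 0 < (Aᵀ *ᵥ u) j := by
    intro j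
    have := hpos j (hmem j)
    rw [hvj] at this
    exact pos_of_mul_pos_right this (h.d_pos (hmem j)).le
  refine ⟨⟨u, fun j => ⟨hupos j, h.d_pos (hmem j), hvj j⟩⟩, ?_⟩
  rintro ⟨x, hAx, hx0, hne⟩
  -- A nonnegative vector orthogonal to a strictly positive one is zero, which contradicts
  -- feasibility.
  have h0 : (Aᵀ *ᵥ u) ⬝ᵥ x = 0 := by
    rw [Matrix.mulVec_transpose, ← Matrix.dotProduct_mulVec, hAx, dotProduct_zero]
  have h1 := (Finset.sum_eq_zero_iff_of_nonneg fun j _ => mul_nonneg (hupos j).le (hx0 j)).1 h0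
  exact hne (funext fun j => (mul_eq_zero.1 (h1 j (Finset.mem_univ j))).resolve_left (hupos j).ne')

/-- A cut halves valid bounds. -/
theorem le_half (h : MAInvariant A L N T s) {v : Fin n → ℝ} (hv : v ∈ rowSpace s.I s.M)
    {j : Fin n} (hj : j ∈ s.I) (hvj : v j ≠ 0) (hcut : cutBound v j ≤ 1 / 2) {x : Fin n → ℝ}
    (hx : IsCubeSolution A x) : x j ≤ s.d j / 2 := by
  -- Rescaling turns `x` into a null vector of the current matrix, in the cube since `x ≤ d`. On
  -- deleted columns the quotient is `0 / 0 = 0`.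
  set x' : Fin n → ℝ := fun k => x k / s.d k with hx'
  have hsupp : SupportedOn s.I x' := fun k hk => by simp [hx', h.d_eq_zero k hk]
  have hdx : (fun k => s.d k * x' k) = x := by
    funext k
    by_cases hk : k ∈ s.I
    · exact mul_div_cancel₀ _ (h.d_pos hk).ne'
    · rw [h.eq_zero_of_notMem hx.1 (fun j => (hx.2 j).1) hk, h.d_eq_zero k hk, zero_mul]
  have hM : s.M *ᵥ x' = 0 := by rw [h.mulVec_eq hsupp, hdx, hx.1]
  have h1 : x' j ≤ 1 / 2 := (le_cutBound (dotProduct_eq_zero_of_mem_rowSpace hv hsupp hM)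
    (fun k => ⟨div_nonneg (hx.2 k).1 (h.d_nonneg k),
      div_le_one_of_le₀ (h.le_d x hx k) (h.d_nonneg k)⟩) hvj).trans hcut
  rw [hx', div_le_iff₀ (h.d_pos hj)] at h1
  linarith

/-- The state after a rescaling by the cut `J`. -/
noncomputable def rescale (s : MAState m n) (τ : ℝ) (J : List (Fin n)) (b : BPCall) :
    MAState m n :=
  let d₁ : Fin n → ℝ := fun i => if i ∈ J then s.d i / 2 else s.d i
  ⟨fun i => if i ∈ s.I.filter (fun i => decide (d₁ i ≤ τ)) then 0 else d₁ i,
    s.I.filter (fun i => !decide (d₁ i ≤ τ)),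
    fun i j => if j ∈ J then s.M i j / 2 else s.M i j, s.rescalings + 1, s.calls ++ [b]⟩

theorem forall_mem_calls (h : MAInvariant A L N T s) {b : BPCall} (hb : b.iterations ≤ N)
    (hb' : b.time ≤ T) : ∀ b' ∈ s.calls ++ [b], b'.iterations ≤ N ∧ b'.time ≤ T := by
  intro b' hmem
  rcases List.mem_append.1 hmem with hmem | hmem
  · exact h.calls b' hmem
  · rw [List.mem_singleton.1 hmem]
    exact ⟨hb, hb'⟩

/-- The hypothesis `hsmall` is the gap: a coordinate bounded by `2^(-L)` on all cube solutions
vanishes on them. Halving keeps `x ≤ d` by `le_half`, and the gap permits replacing a small `d j` by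
`0`. -/
theorem rescale_inv (h : MAInvariant A L N T s)
    (hsmall : ∀ j, (∀ x, IsCubeSolution A x → x j ≤ 1 / 2 ^ L) →
      ∀ x, IsCubeSolution A x → x j = 0)
    {J : List (Fin n)} (hJ : J ≠ []) (hJI : J.Sublist s.I) {v : Fin n → ℝ}
    (hv : v ∈ rowSpace s.I s.M) (hcut : ∀ j ∈ J, v j ≠ 0 ∧ cutBound v j ≤ 1 / 2) {b : BPCall}
    (hb : b.iterations ≤ N) (hb' : b.time ≤ T) :
    MAInvariant A L N T (rescale s (1 / 2 ^ L) J b) := by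
  obtain ⟨e, heL, heI, hsum⟩ := h.scaling
  set d₁ : Fin n → ℝ := fun i => if i ∈ J then s.d i / 2 else s.d i with hd₁
  have hle : ∀ x, IsCubeSolution A x → ∀ j, x j ≤ d₁ j := by
    intro x hx j
    by_cases hj : j ∈ J
    · rw [hd₁]
      simp only [hj, if_true]
      exact h.le_half hv (hJI.subset hj) (hcut j hj).1 (hcut j hj).2 hx
    · simpa only [hd₁, hj, if_false] using h.le_d x hx j
  set H := s.I.filter (fun i => decide (d₁ i ≤ 1 / 2 ^ L)) with hH
  set I' := s.I.filter (fun i => !decide (d₁ i ≤ 1 / 2 ^ L)) with hI'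
  have hmemI' : ∀ j, j ∈ I' ↔ j ∈ s.I ∧ 1 / 2 ^ L < d₁ j := by
    intro j; rw [hI', List.mem_filter]; simp
  have hmemH : ∀ j, j ∈ H ↔ j ∈ s.I ∧ d₁ j ≤ 1 / 2 ^ L := by
    intro j; rw [hH, List.mem_filter]; simp
  have hd₂ : ∀ j ∈ I', (if j ∈ H then 0 else d₁ j) = d₁ j := fun j hj =>
    if_neg fun hj' => absurd ((hmemI' j).1 hj).2 (not_lt.2 ((hmemH j).1 hj').2)
  -- Exponents count the halvings. A remaining column had exponent below `L`, so a halving gives at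
  -- most `L`; a deleted column keeps its last exponent, so the sum never decreases.
  refine ⟨h.nodup.filter _, ⟨fun j => if j ∈ J then e j + 1 else e j, fun j => ?_, ?_, ?_⟩,
    ?_, ?_, ?_, ?_, h.forall_mem_calls hb hb'⟩
  · by_cases hj : j ∈ J
    · simp only [hj, if_true]
      exact (heI j (hJI.subset hj)).1
    · simp only [hj, if_false]
      exact heL j
  · intro j hj
    have hdj : d₁ j = (1 / 2) ^ (if j ∈ J then e j + 1 else e j) := by
      have := (heI j ((hmemI' j).1 hj).1).2
      by_cases hjJ : j ∈ J
      · simp only [hd₁, hjJ, if_true, this, pow_succ]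
        ring
      · simp only [hd₁, hjJ, if_false, this]
    refine ⟨?_, (hd₂ j hj).trans hdj⟩
    -- Surviving the deletion test means `2^(-e j) > 2^(-L)`, which restores the strict inequality.
    have hlt := ((hmemI' j).1 hj).2
    rw [hdj, ← one_div_pow] at hlt
    exact (pow_lt_pow_iff_right_of_lt_one₀ (by norm_num) (by norm_num)).1 hlt
  · show s.rescalings + 1 ≤ _
    obtain ⟨k, hk⟩ := List.exists_mem_of_ne_nil J hJ
    refine Nat.succ_le_of_lt (hsum.trans_lt (Finset.sum_lt_sum (fun j _ => ?_)
      ⟨k, Finset.mem_univ k, ?_⟩))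
    · split_ifs <;> omega
    · rw [if_pos hk]
      omega
  · intro j hj
    show (if j ∈ H then 0 else d₁ j) = 0
    by_cases hjH : j ∈ H
    · rw [if_pos hjH]
    · rw [if_neg hjH]
      have hjI : j ∉ s.I := by
        intro hjI
        rcases le_or_gt (d₁ j) (1 / 2 ^ L) with hle | hlt
        · exact hjH ((hmemH j).2 ⟨hjI, hle⟩)
        · exact hj ((hmemI' j).2 ⟨hjI, hlt⟩)
      have hjJ : j ∉ J := fun hjJ => hjI (hJI.subset hjJ)
      simp only [hd₁, hjJ, if_false]
      exact h.d_eq_zero j hjI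
  · intro i j hj
    show (if j ∈ J then s.M i j / 2 else s.M i j) = A i j * (if j ∈ H then 0 else d₁ j)
    rw [hd₂ j hj, h.matrix i j ((hmemI' j).1 hj).1]
    by_cases hjJ : j ∈ J
    · simp only [hd₁, hjJ, if_true]
      ring
    · simp only [hd₁, hjJ, if_false]
  · intro x hx j
    show x j ≤ (if j ∈ H then 0 else d₁ j)
    by_cases hjH : j ∈ H
    · rw [if_pos hjH]
      -- The already halved bound is at most `τ`, so the gap gives `x j = 0`.
      exact (hsmall j (fun x hx => (hle x hx j).trans ((hmemH j).1 hjH).2) x hx).le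
    · rw [if_neg hjH]
      exact hle x hx j
  · show (s.calls ++ [b]).length = s.rescalings + 1
    rw [List.length_append, h.length_calls]
    rfl

end MAInvariant

/-- The bound on the time of Gram–Schmidt orthogonalization. -/
def rowBasisTime (m n : ℕ) : ℕ := m * (n + m * (n * 7 + 1) + n * 4 + 2)

/-- The bound on the time of a call of the basic procedure with `N` updates. -/
def bpTime (N m n : ℕ) : ℕ :=
  N * (n * 18 + m * (n * 7 + 1) + 8 + 1) + (n * n * 3 + n * 22 + m * (n * 7 + 1) * 2 + 13)

/-- One pass of the main algorithm. -/
theorem maBody_spec {A : Matrix (Fin m) (Fin n) ℝ} {L : ℕ} {c : ℝ} (hc0 : 0 < c) (hc2 : c < 2)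
    (hsmall : ∀ j, (∀ x, IsCubeSolution A x → x j ≤ 1 / 2 ^ L) →
      ∀ x, IsCubeSolution A x → x j = 0)
    {sel : ℕ → List (Fin n) → List (Fin n)} (hsel : IsSelectionRule sel) (s : MAState m n)
    (hs : MAInvariant A L (bpUpdateBound c n) (bpTime (bpUpdateBound c n) m n) s) :
    (∃ R, R.IsValid A L (bpUpdateBound c n) (bpTime (bpUpdateBound c n) m n) ∧
      Within (maBody c (1 / 2 ^ L) sel s) (Sum.inl R)
        (rowBasisTime m n + bpTime (bpUpdateBound c n) m n + n * 7 + n * (m * 2))) ∨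
    ∃ s', MAInvariant A L (bpUpdateBound c n) (bpTime (bpUpdateBound c n) m n) s' ∧
      n * L - s'.rescalings < n * L - s.rescalings ∧
      Within (maBody c (1 / 2 ^ L) sel s) (Sum.inr s')
        (rowBasisTime m n + bpTime (bpUpdateBound c n) m n + n * 7 + n * (m * 2)) := by
  have hr : s.I.length ≤ n := by simpa using hs.nodup.length_le_card
  obtain ⟨W, hWw, hW, hWlen, hspan⟩ := exists_within_rowBasis hs.nodup s.M
  obtain ⟨⟨res, upd⟩, hvalid, hupd, t, ht, hret⟩ := basicProcedure_spec hc0 hc2 hs.nodup hW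
    (hsel s.rescalings)
  rw [hspan] at hvalid
  have hN : bpUpdateBound c s.I.length ≤ bpUpdateBound c n :=
    Nat.mul_le_mul_left _ (Nat.pow_le_pow_left hr 2)
  have hWr : W.length * (s.I.length * 7 + 1) ≤ m * (n * 7 + 1) :=
    Nat.mul_le_mul hWlen (by omega)
  have htT : t ≤ bpTime (bpUpdateBound c n) m n := by
    refine ht.trans (Nat.add_le_add (Nat.mul_le_mul hN (by omega)) ?_)
    have := Nat.mul_le_mul hr hr
    omega
  have hRB : Within (rowBasis s.I s.M) W (rowBasisTime m n) := by
    refine hWw.mono (Nat.mul_le_mul_left m ?_)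
    have := Nat.mul_le_mul_left m (show s.I.length * 7 + 1 ≤ n * 7 + 1 by omega)
    omega
  have hBP : Within (measured (basicProcedure c s.I W (sel s.rescalings))) ((res, upd), t)
      (bpTime (bpUpdateBound c n) m n) := ⟨t, htT, hret.measured⟩
  replace hupd : upd ≤ bpUpdateBound c n := hupd.trans hN
  have hcalls := hs.forall_mem_calls (b := ⟨upd, t⟩) hupd htT
  have hlen : (s.calls ++ [(⟨upd, t⟩ : BPCall)]).length = s.rescalings + 1 := by
    rw [List.length_append, hs.length_calls]
    rfl
  cases res with
  | primal z =>
    obtain ⟨hzI, hz, horth⟩ := hvalid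
    refine Or.inl ⟨⟨Outcome.primal (restrictTo s.I fun i => s.d i * z i), s.rescalings,
      s.calls ++ [⟨upd, t⟩]⟩, ⟨hs.solves_primal hzI hz horth, hs.rescalings_le, hlen, hcalls⟩, ?_⟩
    refine Within.mono (Within.bind hRB (Within.bind hBP (t := n * 3) ?_)) (by omega)
    exact Within.mono (Within.bind (within_tick n) (Within.bind
      (within_tabulate fun i _ => within_mul _ _) (within_pure _))) (by omega)
  | dual v =>
    obtain ⟨hfull, hv, hpos⟩ := hvalid
    refine Or.inl ⟨⟨Outcome.dual s.d v, s.rescalings, s.calls ++ [⟨upd, t⟩]⟩,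
      ⟨hs.solves_dual hfull hv hpos, hs.rescalings_le, hlen, hcalls⟩, ?_⟩
    exact Within.mono (Within.bind hRB (Within.bind hBP (t := 0) (within_pure _))) (by omega)
  | cut J =>
    obtain ⟨hJ, hJI, v, hv, hcut⟩ := hvalid
    have hinv := hs.rescale_inv hsmall hJ hJI hv hcut (b := ⟨upd, t⟩) hupd htT
    -- The bound for the new state ensures that the truncated difference `n * L - rescalings` really
    -- decreases.
    have hdec := hinv.rescalings_le
    have hJlen : J.length ≤ n := hJI.length_le.trans hr
    have hJm := Nat.mul_le_mul_right (m * 2) hJlen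
    have hJn := hJI.nodup hs.nodup
    refine Or.inr ⟨_, hinv, ?_, ?_⟩
    · change s.rescalings + 1 ≤ n * L at hdec
      show n * L - (s.rescalings + 1) < n * L - s.rescalings
      omega
    · refine Within.mono (Within.bind hRB (Within.bind hBP
        (t := n * 7 + n * (m * 2)) ?_)) (by omega)
      refine Within.mono (Within.bind (within_halve hJn s.d)
        (Within.bind (within_select s.I fun i _ => within_le _ _)
        (Within.bind (within_select s.I fun i _ => Within.bind (within_le _ _) (within_pure _))
        (Within.bind (within_zeroOut _ _)
        (Within.bind (within_halveColumns hJn s.M) (within_pure _)))))) ?_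
      have := List.length_filter_le
        (fun i => decide ((if i ∈ J then s.d i / 2 else s.d i) ≤ 1 / 2 ^ L)) s.I
      beta_reduce
      omega

theorem within_powHalf (L : ℕ) :
    Within ((List.range L).foldlM (fun t _ => div t 2) 1) (1 / 2 ^ L) L := by
  have := within_foldlM (f := fun (t : ℝ) (_ : ℕ) => div t 2) (g := fun t _ => t / 2) (k := 1)
    (List.range L) 1 fun s _ _ => within_div s 2
  have h : ∀ (l : List ℕ) (a : ℝ), l.foldl (fun t _ => t / 2) a = a / 2 ^ l.length := by
    intro l
    induction l with
    | nil => simp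
    | cons _ l ih =>
      intro a
      rw [List.foldl_cons, ih, List.length_cons, pow_succ', div_div]
  rwa [h, List.length_range, mul_one] at this

theorem primalAlgorithm_spec [NeZero m] [NeZero n] {A : Matrix (Fin m) (Fin n) ℚ} {c : ℝ}
    (hc0 : 0 < c) (hc2 : c < 2) {sel : ℕ → List (Fin n) → List (Fin n)}
    (hsel : IsSelectionRule sel) :
    ∃ R : Report n, R.IsValid (A.map (fun q : ℚ => (q : ℝ))) (bitSize A) (bpUpdateBound c n)
        (bpTime (bpUpdateBound c n) m n) ∧
      Within (primalAlgorithm c (A.map (fun q : ℚ => (q : ℝ))) (bitSize A) sel) R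
        (bitSize A + n + (n * bitSize A + 1) *
          (rowBasisTime m n + bpTime (bpUpdateBound c n) m n + n * 7 + n * (m * 2) + 1)) := by
  set R := A.map (fun q : ℚ => (q : ℝ)) with hR
  set L := bitSize A with hL
  have hL0 : 0 < L := by
    refine Finset.sum_pos (fun i _ => Finset.sum_pos (fun j _ => by omega) ⟨0, Finset.mem_univ _⟩)
      ⟨0, Finset.mem_univ _⟩
  -- Contrapositive of `exists_feasible_in_cube`; the only place where rationality of the entries
  -- enters.
  have hsmall : ∀ j, (∀ x, IsCubeSolution R x → x j ≤ 1 / 2 ^ L) →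
      ∀ x, IsCubeSolution R x → x j = 0 := by
    intro j hj x hx
    by_contra hne
    obtain ⟨y, hy, hy1, hlt⟩ := exists_feasible_in_cube A (fun k => (hx.2 k).1) hx.1
      (lt_of_le_of_ne (hx.2 j).1 (Ne.symm hne))
    exact absurd (hj y ⟨hy, hy1⟩) (not_le.2 hlt)
  have hd : restrictTo (List.finRange n) (fun _ => (1 : ℝ)) = fun _ => 1 := by
    funext j
    exact restrictTo_apply_of_mem (List.mem_finRange j) _
  have hinv : MAInvariant R L (bpUpdateBound c n) (bpTime (bpUpdateBound c n) m n)
      ⟨restrictTo (List.finRange n) (fun _ => (1 : ℝ)), List.finRange n, R, 0, []⟩ := by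
    rw [hd]
    exact ⟨List.nodup_finRange n, ⟨fun _ => 0, fun _ => hL0.le, fun _ _ => ⟨hL0, by simp⟩,
      Nat.zero_le _⟩, fun j hj => absurd (List.mem_finRange j) hj, fun _ _ _ => (mul_one _).symm,
      fun x hx j => (hx.2 j).2, rfl, by simp⟩
  obtain ⟨rep, hrep, hw⟩ := within_loop _ _ (fun s : MAState m n => n * L - s.rescalings) _ _
    (maBody_spec hc0 hc2 hsmall hsel) _ hinv
  refine ⟨rep, hrep, ?_⟩
  unfold primalAlgorithm
  refine Within.mono (Within.bind (within_powHalf L) (Within.bind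
    (within_tabulate fun i _ => within_pure 1) hw)) (le_of_eq ?_)
  rw [List.length_finRange, Nat.sub_zero]
  ring

/-! ### Absorbing lower-order terms into the time bounds -/

theorem bpTime_le {K m n : ℕ} (hm : 0 < m) (hn : 0 < n) :
    bpTime (K * n ^ 2) m n ≤ (35 * K + 54) * (n ^ 3 * m) := by
  have h1 : n ≤ n * m := Nat.le_mul_of_pos_right n hm
  have h2 : m ≤ n * m := Nat.le_mul_of_pos_left m hn
  have h3 : n * m ≤ n ^ 2 * m := Nat.mul_le_mul_right m (Nat.le_self_pow two_ne_zero n)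
  have h4 : n ^ 2 * m ≤ n ^ 3 * m := Nat.mul_le_mul_right m (Nat.pow_le_pow_right hn (by norm_num))
  have h5 : n ^ 2 ≤ n ^ 2 * m := Nat.le_mul_of_pos_right _ hm
  have h6 : n * 18 + m * (n * 7 + 1) + 8 + 1 ≤ 35 * (n * m) := by
    have : m * (n * 7 + 1) = 7 * (n * m) + m := by ring
    omega
  have h7 : n * n * 3 + n * 22 + m * (n * 7 + 1) * 2 + 13 ≤ 54 * (n ^ 3 * m) := by
    have : m * (n * 7 + 1) * 2 = 14 * (n * m) + 2 * m := by ring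
    have : n * n * 3 = 3 * n ^ 2 := by ring
    omega
  calc bpTime (K * n ^ 2) m n
      ≤ K * n ^ 2 * (35 * (n * m)) + 54 * (n ^ 3 * m) :=
        Nat.add_le_add (Nat.mul_le_mul_left _ h6) h7
    _ = (35 * K + 54) * (n ^ 3 * m) := by ring

/-- Orthogonalization costs `O(n m²)`, which fits the budget of one pass because `m ≤ n`. -/
theorem rowBasisTime_le {m n : ℕ} (hm : 0 < m) (hmn : m ≤ n) :
    rowBasisTime m n ≤ 15 * (n ^ 3 * m) := by
  have hn : 0 < n := hm.trans_le hmn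
  have h1 : n ≤ n * m := Nat.le_mul_of_pos_right n hm
  have h2 : m ≤ n * m := Nat.le_mul_of_pos_left m hn
  have h3 : n * m ≤ n ^ 3 := by
    calc n * m ≤ n * n := Nat.mul_le_mul_left n hmn
      _ = n ^ 2 := (sq n).symm
      _ ≤ n ^ 3 := Nat.pow_le_pow_right hn (by norm_num)
  have h4 : n + m * (n * 7 + 1) + n * 4 + 2 ≤ 15 * n ^ 3 := by
    have : m * (n * 7 + 1) = 7 * (n * m) + m := by ring
    omega
  calc rowBasisTime m n ≤ m * (15 * n ^ 3) := Nat.mul_le_mul_left m h4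
    _ = 15 * (n ^ 3 * m) := by ring

theorem total_time_le {K L m n : ℕ} (hm : 0 < m) (hmn : m ≤ n) (hL : 0 < L) :
    L + n + (n * L + 1) *
      (rowBasisTime m n + bpTime (K * n ^ 2) m n + n * 7 + n * (m * 2) + 1) ≤
      (70 * K + 160) * (n ^ 4 * m * L) := by
  have hn : 0 < n := hm.trans_le hmn
  have h1 : n ≤ n ^ 3 * m := (Nat.le_self_pow three_ne_zero n).trans (Nat.le_mul_of_pos_right _ hm)
  have h2 : n * (m * 2) ≤ 2 * (n ^ 3 * m) := by
    have := Nat.mul_le_mul_right m (Nat.le_self_pow three_ne_zero n)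
    have : n * (m * 2) = 2 * (n * m) := by ring
    omega
  have h3 := rowBasisTime_le hm hmn
  have h4 := bpTime_le (K := K) hm hn
  have h5 : rowBasisTime m n + bpTime (K * n ^ 2) m n + n * 7 + n * (m * 2) + 1 ≤
      (35 * K + 79) * (n ^ 3 * m) := by
    have : (35 * K + 79) * (n ^ 3 * m) =
        (35 * K + 54) * (n ^ 3 * m) + 25 * (n ^ 3 * m) := by ring
    omega
  have h6 : n * L + 1 ≤ 2 * (n * L) := by
    have := Nat.mul_pos hn hL
    omega
  have h7 : L ≤ n ^ 4 * m * L := Nat.le_mul_of_pos_left L (by positivity)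
  have h8 : n ≤ n ^ 4 * m * L := by
    calc n ≤ n ^ 4 := Nat.le_self_pow four_ne_zero n
      _ ≤ n ^ 4 * (m * L) := Nat.le_mul_of_pos_right _ (by positivity)
      _ = n ^ 4 * m * L := by ring
  calc _ ≤ n ^ 4 * m * L + n ^ 4 * m * L + 2 * (n * L) * ((35 * K + 79) * (n ^ 3 * m)) :=
        Nat.add_le_add (Nat.add_le_add h7 h8) (Nat.mul_le_mul h6 h5)
    _ = (70 * K + 160) * (n ^ 4 * m * L) := by ring

end MainAlgorithm

theorem theorem1 :
    (∀ (m n : ℕ) (I : List (Fin n)) (M : Matrix (Fin m) (Fin n) ℝ), I.Nodup →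
      ComputesRowProjection I M) ∧
    ∀ c : ℝ, 0 < c → c < 2 → ∃ C : ℕ, ∀ (m n : ℕ) (A : Matrix (Fin m) (Fin n) ℚ),
      0 < m → A.rank = m →
      ∀ sel : ℕ → List (Fin n) → List (Fin n), IsSelectionRule sel →
        ∃ (R : Report n) (time : ℕ),
          (primalAlgorithm c (A.map (fun q : ℚ => (q : ℝ))) (bitSize A) sel).Returns R time ∧
          R.outcome.Solves (A.map (fun q : ℚ => (q : ℝ))) ∧
          R.rescalings ≤ n * bitSize A ∧
          R.calls.length = R.rescalings + 1 ∧
          (∀ b ∈ R.calls, b.iterations ≤ C * n ^ 2 ∧ b.time ≤ C * (n ^ 3 * m)) ∧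
          time ≤ C * (n ^ 4 * m * bitSize A) := by
  refine ⟨fun m n I M hI => computesRowProjection hI M, fun c hc0 hc2 => ?_⟩
  set K := ⌈4 / (c * (2 - c))⌉₊ with hK
  -- The constant of the total time; it also dominates `K` for the updates and `35 * K + 54` for the
  -- time of a call.
  refine ⟨70 * K + 160, fun m n A hm hrank sel hsel => ?_⟩
  -- Full row rank enters only through this inequality.
  have hmn : m ≤ n := hrank ▸ A.rank_le_width
  have hn : 0 < n := hm.trans_le hmn
  have : NeZero m := ⟨hm.ne'⟩
  have : NeZero n := ⟨hn.ne'⟩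
  obtain ⟨R, hR, time, htime, hret⟩ := primalAlgorithm_spec (A := A) hc0 hc2 hsel
  have hL : 0 < bitSize A :=
    Finset.sum_pos (fun i _ => Finset.sum_pos (fun j _ => by omega) ⟨0, Finset.mem_univ _⟩)
      ⟨0, Finset.mem_univ _⟩
  refine ⟨R, time, hret, hR.solves, hR.rescalings, hR.length_calls, fun b hb => ?_,
    htime.trans (total_time_le hm hmn hL)⟩
  obtain ⟨h1, h2⟩ := hR.calls b hb
  exact ⟨h1.trans (Nat.mul_le_mul_right _ (by omega)),
    h2.trans ((bpTime_le hm hn).trans (Nat.mul_le_mul_right _ (by omega)))⟩
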